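/- For positive integers $k$ and integers $n\ge 0$ let $\Delta_{n,k}=\{x\in[0,1]^n:\ \|x\|_1\le k\}$, where $\|x\|_1=\sum_i|x_i|$, and write $[n]=\{1,\dots,n\}$. For a real $\alpha$, an $\alpha$-stretch correlated sampling algorithm for $\Delta_{n,k}$ is a random map $A$ (a distribution over deterministic maps, drawn once and then used for all inputs) from $\Delta_{n,k}$ to the subsets of $[n]$ of cardinality at most $k$, such that for all $x,y\in\Delta_{n,k}$: 1. (Cardinality) for every realization of $A$, $|A(x)|\in\{\lfloor\|x\|_1\rfloor,\lceil\|x\|_1\rceil\}$; 2. (Marginals) $\Pr[i\in A(x)]=x_i$ for all $i\in[n]$; 3. (Stretch) $\mathbb{E}\,|A(x)\oplus A(y)|\le\alpha\cdot\|x-y\|_1$, where $\oplus$ is the symmetric difference. Theorem. There is an absolute constant $C>0$ such that for all $n\ge 0$ and $k\ge 1$ there exists a correlated sampling algorithm for $\Delta_{n,k}$ with stretch $C\cdot\max\{1,\log_2 k\}$. In particular, for $k\ge 2$ the stretch is at most $C\log_2 k$, independently of $n$. -/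

import Mathlib

open MeasureTheory

/-- The `ℓ₁` norm of a vector `x ∈ ℝⁿ`. -/
def l1Norm {n : ℕ} (x : Fin n → ℝ) : ℝ := ∑ i, |x i|

/-- `Δ_{n,k}`: the points of `[0,1]ⁿ` whose `ℓ₁` norm is at most `k`. -/
def hypersimplex (n k : ℕ) : Set (Fin n → ℝ) :=
  {x | (∀ i, 0 ≤ x i ∧ x i ≤ 1) ∧ l1Norm x ≤ k}

/-- A deterministic rounding map: it sends each point of `Δ_{n,k}` to a subset of `[n]` of
cardinality at most `k`. -/
abbrev DetRounding (n k : ℕ) : Type :=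
  hypersimplex n k → {S : Finset (Fin n) // S.card ≤ k}

/-- `A` is an `α`-stretch correlated sampling algorithm for `Δ_{n,k}`. The random seed `ω` is drawn
once from the probability measure `μ`; it determines the whole deterministic map `A ω`, which is
then used for all inputs. Thus the law of `A` is a distribution over deterministic maps. -/
structure IsCorrelatedSampling {Ω : Type*} [MeasurableSpace Ω] (n k : ℕ) (α : ℝ)
    (μ : Measure Ω) (A : Ω → DetRounding n k) : Prop where
  /-- The seed is drawn from a probability distribution. -/
  isProbabilityMeasure : IsProbabilityMeasure μ
  /-- For every input the output is a random variable (with values in a finite discrete space). -/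
  measurableSet_eq : ∀ (x : hypersimplex n k) (S : Finset (Fin n)),
    MeasurableSet {ω | (A ω x).1 = S}
  /-- Cardinality: for every seed and every input the output has `⌊‖x‖₁⌋` or `⌈‖x‖₁⌉` elements. -/
  cardinality : ∀ (ω : Ω) (x : hypersimplex n k),
    (A ω x).1.card = ⌊l1Norm x.1⌋₊ ∨ (A ω x).1.card = ⌈l1Norm x.1⌉₊
  /-- Marginals: the element `i` is in the output with probability exactly `x i`. -/
  marginals : ∀ (x : hypersimplex n k) (i : Fin n), μ.real {ω | i ∈ (A ω x).1} = x.1 i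
  /-- Stretch: the expected size of the symmetric difference of the outputs on `x` and `y`, for the
  same seed, is at most `α ‖x - y‖₁`. -/
  stretch : ∀ x y : hypersimplex n k,
    ∫ ω, ((symmDiff (A ω x).1 (A ω y).1).card : ℝ) ∂μ ≤ α * l1Norm (x.1 - y.1)

/-! An integer count is passed down a binary tree whose leaves carry the entries of `x` (the `n`
coordinates sit among `2 ^ n` leaves, the others have mass 0). A node of mass `s` holds a rounding
`N` of `s`, treated as `⌈s - u⌉` with `u` uniform: `u` is redrawn from its law given `N`, and the
left child of mass `a` gets `⌈a - u⌉`. Both children then hold roundings of their masses, means are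
preserved (`integral_nodeCount`), and for fixed seeds the count of a growing child is monotone
(`leftCount_mono`, `sub_leftCount_mono`).

If the mass below one node grows by `δ`, every count on the path to it grows, by `δ` in expectation.
In a subtree hanging off the path the masses are equal, so its leaves contribute only the change at
its root, which is bounded by the changes at two consecutive path nodes. Each level with nonzero
sibling mass thus costs `2 * δ` (`integral_sum_abs_count_sub_le`). It remains to make the mean
number of relevant levels `O(log k)`, whatever `n` is.

The leaf positions are random, so the mean mass sharing a depth-`d` cell with a given leaf is at
most `k / 2 ^ d` (`sum_card_crowdedDepths_le`). Entries of at least `1/8` are so few that below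
depth about `log k` a leaf rarely meets another one. Small entries can be numerous, so the tree is
cut for them: a topmost node of mass at most `τ` puts its whole mass on one leaf, chosen
proportionally to mass by exponential clocks (`concentrate`). Above the cut the mass exceeds `1/2`,
which again happens at `O(log k)` depths on average.

The discontinuities are smoothed by randomness. A uniform `τ` makes the cut move with probability at
most `2 * δ` per relevant depth; the clocks change the winner with probability at most `δ / (s +
δ)`, at cost `2 * s + δ`; a random threshold between heavy and light entries changes the split by at
most `17 * ‖x - y‖₁` in mean (`lintegral_splitMass_sub_le`). Heavy and light copies form the two
halves of one tree (`pairCode`), so the total count still rounds `‖x‖₁`. -/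

/-! ### Splitting an integer between two real masses -/

/-- The integer `N` is one of the two roundings of the real number `s`. -/
def IsRounding (s : ℝ) (N : ℤ) : Prop := s - 1 < N ∧ (N : ℝ) < s + 1

/-- If `N = ⌈s - u⌉`, the seed `u` is resampled from its range given `N`, with fresh seed `t`. -/
noncomputable def resample (s : ℝ) (N : ℤ) (t : ℝ) : ℝ :=
  (1 - t) * max 0 (s - N) + t * min 1 (s - N + 1)

/-- The part of `N`, a rounding of `s`, that goes to a part of mass `a`. -/
noncomputable def leftCount (s a : ℝ) (N : ℤ) (t : ℝ) : ℤ := ⌈a - resample s N t⌉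

section Kernel

variable {s s' a a' t : ℝ} {N N' : ℤ}

/-- The equation `⌈s - u⌉ = N` means `s - N ≤ u < s - N + 1`. As `N` rounds `s`, this interval meets
`[0, 1)`, and the seed is a point of the intersection. -/
lemma resample_mem (hN : IsRounding s N) (ht0 : 0 ≤ t) (ht1 : t < 1) :
    0 ≤ resample s N t ∧ resample s N t < 1 ∧ s - N ≤ resample s N t ∧
      resample s N t < s - N + 1 := by
  obtain ⟨h1, h2⟩ := hN
  unfold resample
  set lo := max 0 (s - N) with hlo
  set hi := min 1 (s - N + 1) with hhi
  have e1 : 0 ≤ lo := le_max_left _ _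
  have e2 : s - N ≤ lo := le_max_right _ _
  have e3 : hi ≤ 1 := min_le_left _ _
  have e4 : hi ≤ s - N + 1 := min_le_right _ _
  have e5 : lo < hi := by
    rw [hlo, hhi]
    refine max_lt (lt_min ?_ ?_) (lt_min ?_ ?_) <;> linarith
  have e6 : lo ≤ (1 - t) * lo + t * hi := by nlinarith
  have e7 : (1 - t) * lo + t * hi < hi := by nlinarith
  refine ⟨?_, ?_, ?_, ?_⟩ <;> linarith

lemma isRounding_leftCount (hN : IsRounding s N) (ht0 : 0 ≤ t) (ht1 : t < 1) :
    IsRounding a (leftCount s a N t) := by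
  obtain ⟨h1, h2, -, -⟩ := resample_mem hN ht0 ht1
  have h3 := Int.le_ceil (a - resample s N t)
  have h4 := Int.ceil_lt_add_one (a - resample s N t)
  constructor <;> unfold leftCount <;> linarith

/-- The redrawn seed `u` satisfies `N = ⌈s - u⌉`, so the right part is `⌈s - u⌉ - ⌈a - u⌉`, within 1
of `s - a`. -/
lemma isRounding_sub_leftCount (hN : IsRounding s N) (ht0 : 0 ≤ t) (ht1 : t < 1) :
    IsRounding (s - a) (N - leftCount s a N t) := by
  obtain ⟨-, -, h1, h2⟩ := resample_mem hN ht0 ht1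
  have h3 := Int.le_ceil (a - resample s N t)
  have h4 := Int.ceil_lt_add_one (a - resample s N t)
  constructor <;> unfold leftCount <;> push_cast <;> linarith

lemma IsRounding.eq_zero (hN : IsRounding 0 N) : N = 0 := by
  obtain ⟨h1, h2⟩ := hN
  have h3 : (-1 : ℤ) < N := by exact_mod_cast (by linarith : (-1 : ℝ) < N)
  have h4 : N < (1 : ℤ) := by exact_mod_cast (by linarith : (N : ℝ) < 1)
  omega

lemma IsRounding.nonneg (hN : IsRounding s N) (hs : 0 ≤ s) : 0 ≤ N := by
  have h3 : (-1 : ℤ) < N := by exact_mod_cast (by linarith [hN.1] : (-1 : ℝ) < N)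
  omega

lemma IsRounding.le_one (hN : IsRounding s N) (hs : s ≤ 1) : N ≤ 1 := by
  have h3 : N < (2 : ℤ) := by exact_mod_cast (by linarith [hN.2] : (N : ℝ) < 2)
  omega

lemma IsRounding.eq_floor_or (hN : IsRounding s N) : N = ⌊s⌋ ∨ N = ⌊s⌋ + 1 := by
  have h1 := Int.floor_le s
  have h2 := Int.lt_floor_add_one s
  have h3 : ⌊s⌋ < N + 1 := by
    exact_mod_cast (by push_cast; linarith [hN.1] : ((⌊s⌋ : ℤ) : ℝ) < ((N + 1 : ℤ) : ℝ))
  have h4 : N < ⌊s⌋ + 2 := by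
    exact_mod_cast (by push_cast; linarith [hN.2] : ((N : ℤ) : ℝ) < ((⌊s⌋ + 2 : ℤ) : ℝ))
  omega

lemma isRounding_ceil_sub (ht0 : 0 ≤ t) (ht1 : t < 1) : IsRounding s ⌈s - t⌉ := by
  have h3 := Int.le_ceil (s - t)
  have h4 := Int.ceil_lt_add_one (s - t)
  constructor <;> linarith

/-- Both ends of the seed range are antitone in `N`, monotone in `s`, and 1-Lipschitz in each; this
and the next three lemmas transfer this to the convex combination. -/
lemma resample_antitone (ht0 : 0 ≤ t) (ht1 : t < 1) (h : N ≤ N') :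
    resample s N' t ≤ resample s N t := by
  have h' : (N : ℝ) ≤ N' := by exact_mod_cast h
  unfold resample
  have : 0 ≤ 1 - t := by linarith
  gcongr

lemma resample_sub_le (ht0 : 0 ≤ t) (ht1 : t < 1) (h : N ≤ N') :
    resample s N t - (N' - N) ≤ resample s N' t := by
  have h' : (N : ℝ) ≤ N' := by exact_mod_cast h
  unfold resample
  have e1 : max 0 (s - N) - (N' - N) ≤ max 0 (s - N') := by
    rw [sub_le_iff_le_add]
    refine max_le ?_ ?_
    · linarith [le_max_left 0 (s - (N' : ℝ))]
    · linarith [le_max_right 0 (s - (N' : ℝ))]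
  have e2 : min 1 (s - N + 1) - (N' - N) ≤ min 1 (s - N' + 1) := by
    refine le_min ?_ ?_
    · linarith [min_le_left 1 (s - (N : ℝ) + 1)]
    · linarith [min_le_right 1 (s - (N : ℝ) + 1)]
  nlinarith

lemma resample_mono (ht0 : 0 ≤ t) (ht1 : t < 1) (h : s ≤ s') :
    resample s N t ≤ resample s' N t := by
  unfold resample
  have : 0 ≤ 1 - t := by linarith
  gcongr

lemma resample_add_le (ht0 : 0 ≤ t) (ht1 : t < 1) (h : s ≤ s') :
    resample s' N t ≤ resample s N t + (s' - s) := by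
  unfold resample
  have e1 : max 0 (s' - N) ≤ max 0 (s - N) + (s' - s) := by
    refine max_le ?_ ?_
    · linarith [le_max_left 0 (s - (N : ℝ))]
    · linarith [le_max_right 0 (s - (N : ℝ))]
  have e2 : min 1 (s' - N + 1) ≤ min 1 (s - N + 1) + (s' - s) := by
    rw [← sub_le_iff_le_add]
    refine le_min ?_ ?_
    · linarith [min_le_left 1 (s' - (N : ℝ) + 1)]
    · linarith [min_le_right 1 (s' - (N : ℝ) + 1)]
  nlinarith

/-- The growth of `s` raises the seed by at most `s' - s`, which is what `a` gains, and the growth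
of `N` only lowers it. So `a - u` does not decrease. -/
lemma leftCount_mono (ht0 : 0 ≤ t) (ht1 : t < 1) (hs : s ≤ s') (ha : s' - s = a' - a)
    (h : N ≤ N') : leftCount s a N t ≤ leftCount s' a' N' t := by
  refine Int.ceil_le_ceil ?_
  linarith [resample_antitone (s := s') ht0 ht1 h, resample_add_le (N := N) ht0 ht1 hs]

/-- Here the right part grows and `a` is fixed. The seed falls by at most `N' - N`, so the left part
gains at most `N' - N`. -/
lemma sub_leftCount_mono (ht0 : 0 ≤ t) (ht1 : t < 1) (hs : s ≤ s') (h : N ≤ N') :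
    N - leftCount s a N t ≤ N' - leftCount s' a N' t := by
  have : leftCount s' a N' t ≤ leftCount s a N t + (N' - N) := by
    unfold leftCount
    rw [← Int.ceil_add_intCast]
    refine Int.ceil_le_ceil ?_
    push_cast
    linarith [resample_sub_le (s := s') ht0 ht1 h, resample_mono (N := N) ht0 ht1 hs]
  omega

/-! ### Mean of the splitting kernel -/

lemma intervalIntegrable_ceil_sub (a b c : ℝ) :
    IntervalIntegrable (fun v : ℝ => ((⌈a - v⌉ : ℤ) : ℝ)) volume b c := by
  refine AntitoneOn.intervalIntegrable fun x _ y _ hxy => ?_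
  exact_mod_cast Int.ceil_le_ceil (by linarith)

lemma integral_ceil_sub (a : ℝ) : ∫ v in (0 : ℝ)..1, ((⌈a - v⌉ : ℤ) : ℝ) = a := by
  have h0 := Int.fract_nonneg a
  have h1 := (Int.fract_lt_one a).le
  have h2 := Int.floor_add_fract a
  rw [← intervalIntegral.integral_add_adjacent_intervals (b := Int.fract a)
    (intervalIntegrable_ceil_sub _ _ _) (intervalIntegrable_ceil_sub _ _ _)]
  rw [intervalIntegral.integral_congr_Ioo_of_le (g := fun _ => (⌊a⌋ : ℝ) + 1) h0,
    intervalIntegral.integral_congr_Ioo_of_le (g := fun _ => (⌊a⌋ : ℝ)) h1]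
  · simp only [intervalIntegral.integral_const, smul_eq_mul]
    linarith
  · intro v hv
    simp only
    norm_cast
    rw [Int.ceil_eq_iff]
    constructor <;> linarith [hv.1, hv.2, Int.fract_lt_one a]
  · intro v hv
    simp only
    norm_cast
    rw [Int.ceil_eq_iff]
    push_cast
    constructor <;> linarith [hv.1, hv.2, Int.fract_lt_one a]

/-- Averaged over the two roundings of `s`, the left part receives its mass. -/
lemma integral_leftCount (s a : ℝ) :
    (1 - Int.fract s) * (∫ t in (0 : ℝ)..1, (leftCount s a ⌊s⌋ t : ℝ)) +
      Int.fract s * (∫ t in (0 : ℝ)..1, (leftCount s a (⌊s⌋ + 1) t : ℝ)) = a := by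
  have h0 := Int.fract_nonneg s
  have h1 := (Int.fract_lt_one s).le
  have h2 := Int.floor_add_fract s
  set f := Int.fract s
  -- The lower rounding redraws the seed uniformly from `[f, 1)`, the upper one from `[0, f)`. The
  -- weights `1 - f` and `f` are the lengths of these intervals, so the two means join into one
  -- integral over `[0, 1]`.
  have e1 : ∀ t, resample s ⌊s⌋ t = f + (1 - f) * t := by
    intro t
    unfold resample
    rw [max_eq_right (by linarith), min_eq_left (by linarith)]
    linear_combination (-(1 - t)) * h2
  have e2 : ∀ t, resample s (⌊s⌋ + 1) t = f * t := by
    intro t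
    unfold resample
    push_cast
    rw [max_eq_left (by linarith), min_eq_right (by linarith)]
    linear_combination (-t) * h2
  simp only [leftCount, e1, e2]
  have i1 := intervalIntegral.smul_integral_comp_add_mul (a := 0) (b := 1)
    (fun v => ((⌈a - v⌉ : ℤ) : ℝ)) (1 - f) f
  have i2 := intervalIntegral.smul_integral_comp_mul_left (a := 0) (b := 1)
    (fun v => ((⌈a - v⌉ : ℤ) : ℝ)) f
  simp only [smul_eq_mul, mul_zero, mul_one, add_zero] at i1 i2
  rw [i1, i2, add_comm, show f + (1 - f) = 1 by ring,
    intervalIntegral.integral_add_adjacent_intervals (intervalIntegrable_ceil_sub _ _ _)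
      (intervalIntegrable_ceil_sub _ _ _), integral_ceil_sub]

end Kernel

/-! ### Counts on a binary tree

The leaves are coded by bit sequences; a node at depth `d` is the set of leaves that share their
first `d` bits. -/

section Tree

variable {Λ : Type*} [Fintype Λ] (code : Λ → ℕ → Bool)

/-- The leaves below the depth-`d` ancestor of `p`. -/
def cell (d : ℕ) (p : Λ) : Finset Λ := Finset.univ.filter fun q => ∀ e < d, code q e = code p e

/-- The leaves below one of the two children of the depth-`d` ancestor of `p`. -/
def halfCell (d : ℕ) (p : Λ) (c : Bool) : Finset Λ := (cell code d p).filter fun q => code q d = c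

/-- The mass of the depth-`d` ancestor of `p`. -/
def cellMass (z : Λ → ℝ) (d : ℕ) (p : Λ) : ℝ := ∑ q ∈ cell code d p, z q

/-- The mass of a child of the depth-`d` ancestor of `p`. -/
def halfMass (z : Λ → ℝ) (d : ℕ) (p : Λ) (c : Bool) : ℝ := ∑ q ∈ halfCell code d p c, z q

/-- The part of a count `N` that goes to the child `c` of a node. -/
noncomputable def splitCount (z : Λ → ℝ) (d : ℕ) (p : Λ) (N : ℤ) (t : ℝ) (c : Bool) : ℤ :=
  if c then N - leftCount (cellMass code z d p) (halfMass code z d p false) N t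
  else leftCount (cellMass code z d p) (halfMass code z d p false) N t

/-- The integer count of the depth-`d` ancestor of `p`, computed from the root downwards with one
random seed for each level. -/
noncomputable def nodeCount (z : Λ → ℝ) (t : ℕ → ℝ) : ℕ → Λ → ℤ
  -- Fractional parts put the seeds in `[0, 1)` for every `t`, not just almost every one: the
  -- cardinality condition must hold for each realization.
  | 0, _ => ⌈(∑ q, z q) - Int.fract (t 0)⌉
  | d + 1, p => splitCount code z d p (nodeCount z t d p) (Int.fract (t (d + 1))) (code p d)

/-- The count of a child of the depth-`d` ancestor of `p`. -/
noncomputable def halfCount (z : Λ → ℝ) (t : ℕ → ℝ) (d : ℕ) (p : Λ) (c : Bool) : ℤ :=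
  splitCount code z d p (nodeCount code z t d p) (Int.fract (t (d + 1))) c

variable {code} {z z' : Λ → ℝ} {t : ℕ → ℝ} {d e D : ℕ} {p q r : Λ}

lemma mem_cell : q ∈ cell code d p ↔ ∀ e < d, code q e = code p e := by simp [cell]

lemma self_mem_cell : p ∈ cell code d p := mem_cell.2 fun _ _ => rfl

lemma cell_zero : cell code 0 p = Finset.univ := by simp [cell]

lemma cell_eq_of_mem (h : q ∈ cell code d p) : cell code d q = cell code d p := by
  rw [mem_cell] at h
  ext r
  rw [mem_cell, mem_cell]
  exact forall₂_congr fun e he => by rw [h e he]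

lemma cell_anti (h : e ≤ d) : cell code d p ⊆ cell code e p := fun _ hq =>
  mem_cell.2 fun i hi => mem_cell.1 hq i (hi.trans_le h)

lemma mem_cell_comm : q ∈ cell code d p ↔ p ∈ cell code d q := by
  rw [mem_cell, mem_cell]
  exact forall₂_congr fun e _ => eq_comm

lemma mem_halfCell {c : Bool} : q ∈ halfCell code d p c ↔ q ∈ cell code d p ∧ code q d = c := by
  simp [halfCell]

lemma halfCell_congr (h : q ∈ cell code d p) (c : Bool) :
    halfCell code d q c = halfCell code d p c := by
  rw [halfCell, halfCell, cell_eq_of_mem h]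

lemma cell_succ : cell code (d + 1) p = halfCell code d p (code p d) := by
  ext q
  rw [mem_halfCell, mem_cell, mem_cell]
  constructor
  · exact fun h => ⟨fun e he => h e (by omega), h d (by omega)⟩
  · rintro ⟨h1, h2⟩ e he
    rcases Nat.lt_succ_iff_lt_or_eq.1 he with h | rfl
    · exact h1 e h
    · exact h2

lemma cell_succ_of_mem {c : Bool} (h : q ∈ halfCell code d p c) :
    cell code (d + 1) q = halfCell code d p c := by
  rw [mem_halfCell] at h
  rw [cell_succ, halfCell_congr h.1, h.2]

lemma sum_cell (f : Λ → ℝ) (d : ℕ) (p : Λ) (c : Bool) :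
    ∑ q ∈ cell code d p, f q =
      ∑ q ∈ halfCell code d p c, f q + ∑ q ∈ halfCell code d p (!c), f q := by
  unfold halfCell
  rw [← Finset.sum_filter_add_sum_filter_not (cell code d p) (fun q => code q d = c)]
  simp only [Bool.eq_not]

lemma cellMass_eq (z : Λ → ℝ) (d : ℕ) (p : Λ) (c : Bool) :
    cellMass code z d p = halfMass code z d p c + halfMass code z d p (!c) := sum_cell z d p c

lemma cellMass_zero : cellMass code z 0 p = ∑ q, z q := by rw [cellMass, cell_zero]

lemma cellMass_succ : cellMass code z (d + 1) p = halfMass code z d p (code p d) := by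
  rw [cellMass, cell_succ, halfMass]

lemma cellMass_congr (h : q ∈ cell code d p) : cellMass code z d q = cellMass code z d p := by
  rw [cellMass, cellMass, cell_eq_of_mem h]

lemma halfMass_congr (h : q ∈ cell code d p) (c : Bool) :
    halfMass code z d q c = halfMass code z d p c := by
  rw [halfMass, halfMass, halfCell_congr h]

lemma cellMass_nonneg (hz : ∀ q, 0 ≤ z q) : 0 ≤ cellMass code z d p :=
  Finset.sum_nonneg fun q _ => hz q

lemma cell_eq_singleton (hD : ∀ q p, (∀ e < D, code q e = code p e) → q = p) :
    cell code D p = {p} := by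
  ext q
  rw [mem_cell, Finset.mem_singleton]
  exact ⟨hD q p, fun h => h ▸ fun _ _ => rfl⟩

lemma nodeCount_succ : nodeCount code z t (d + 1) p = halfCount code z t d p (code p d) := rfl

lemma halfCount_add (c : Bool) :
    halfCount code z t d p c + halfCount code z t d p (!c) = nodeCount code z t d p := by
  cases c <;> simp [halfCount, splitCount]

lemma isRounding_splitCount {N : ℤ} {u : ℝ} (h : IsRounding (cellMass code z d p) N) (hu0 : 0 ≤ u)
    (hu1 : u < 1) (c : Bool) : IsRounding (halfMass code z d p c) (splitCount code z d p N u c) := by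
  cases c
  · simpa [splitCount] using isRounding_leftCount h hu0 hu1
  · have h1 := isRounding_sub_leftCount (a := halfMass code z d p false) h hu0 hu1
    rw [cellMass_eq z d p false, add_sub_cancel_left] at h1
    rw [splitCount, if_pos rfl, cellMass_eq z d p false]
    exact h1

lemma isRounding_count : IsRounding (cellMass code z d p) (nodeCount code z t d p) := by
  induction d generalizing p with
  | zero =>
    rw [cellMass_zero]
    exact isRounding_ceil_sub (Int.fract_nonneg _) (Int.fract_lt_one _)
  | succ d ih =>
    rw [cellMass_succ, nodeCount_succ]
    exact isRounding_splitCount ih (Int.fract_nonneg _) (Int.fract_lt_one _) _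

lemma isRounding_halfCount (c : Bool) :
    IsRounding (halfMass code z d p c) (halfCount code z t d p c) :=
  isRounding_splitCount isRounding_count (Int.fract_nonneg _) (Int.fract_lt_one _) c

lemma nodeCount_congr (h : q ∈ cell code d p) : nodeCount code z t d q = nodeCount code z t d p := by
  induction d with
  | zero => rfl
  | succ d ih =>
    have h1 := cell_anti (Nat.le_succ d) h
    rw [nodeCount_succ, nodeCount_succ, halfCount, halfCount, ih h1, splitCount, splitCount,
      cellMass_congr h1, halfMass_congr h1, mem_cell.1 h d (Nat.lt_succ_self d)]

lemma nodeCount_eq_halfCount {c : Bool} (h : q ∈ halfCell code d p c) :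
    nodeCount code z t (d + 1) q = halfCount code z t d p c := by
  rw [mem_halfCell] at h
  rw [nodeCount_succ, halfCount, halfCount, nodeCount_congr h.1, splitCount, splitCount,
    cellMass_congr h.1, halfMass_congr h.1, h.2]

/-- The counts of the leaves below a node add up to the count of the node. -/
lemma sum_count (hD : ∀ q p, (∀ e < D, code q e = code p e) → q = p) (hd : d ≤ D) :
    ∑ q ∈ cell code d p, (nodeCount code z t D q : ℝ) = nodeCount code z t d p := by
  induction hd using Nat.decreasingInduction generalizing p with
  | self => rw [cell_eq_singleton hD, Finset.sum_singleton]
  | of_succ d hd ih =>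
    have key : ∀ c, ∑ q ∈ halfCell code d p c, (nodeCount code z t D q : ℝ) =
        halfCount code z t d p c := by
      intro c
      -- An empty half has no leaf through which to name its node; its mass 0 forces the count 0.
      rcases (halfCell code d p c).eq_empty_or_nonempty with h | ⟨r, hr⟩
      · have h1 := isRounding_halfCount (code := code) (z := z) (t := t) (d := d) (p := p) c
        rw [halfMass, h, Finset.sum_empty] at h1
        rw [h, Finset.sum_empty, h1.eq_zero, Int.cast_zero]
      · rw [← cell_succ_of_mem hr, ih, nodeCount_eq_halfCount hr]
    rw [sum_cell _ d p false, key, key, ← halfCount_add false]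
    push_cast
    rfl

/-- The two cases of the kernel: if the left child grows, `s` and `a` grow by the same amount; if
the right child grows, `a` is fixed. -/
lemma splitCount_mono {N N' : ℤ} {u : ℝ} (hu0 : 0 ≤ u) (hu1 : u < 1) (c : Bool) (hN : N ≤ N')
    (h1 : halfMass code z d p c ≤ halfMass code z' d p c)
    (h2 : halfMass code z d p (!c) = halfMass code z' d p (!c)) :
    splitCount code z d p N u c ≤ splitCount code z' d p N' u c := by
  cases c
  · simp only [splitCount, Bool.false_eq_true, if_false]
    refine leftCount_mono hu0 hu1 ?_ ?_ hN
    · rw [cellMass_eq z d p false, cellMass_eq z' d p false, h2]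
      linarith
    · rw [cellMass_eq z d p false, cellMass_eq z' d p false, h2]
      ring
  · simp only [Bool.not_true] at h2
    simp only [splitCount, if_true, h2]
    refine sub_leftCount_mono hu0 hu1 ?_ hN
    rw [cellMass_eq z d p false, cellMass_eq z' d p false, h2]
    simpa using h1

/-- On a part of the tree with equal masses, the counts are monotone in the count of the root. -/
lemma nodeCount_mono_of_eq (hz : ∀ q ∈ cell code d p, z q = z' q)
    (h : nodeCount code z t d p ≤ nodeCount code z' t d p) (he : d ≤ e) (hq : q ∈ cell code d p) :
    nodeCount code z t e q ≤ nodeCount code z' t e q := by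
  induction e, he using Nat.le_induction with
  | base => rwa [nodeCount_congr hq, nodeCount_congr hq]
  | succ e he ih =>
    have hm : ∀ c, halfMass code z e q c = halfMass code z' e q c := fun c =>
      Finset.sum_congr rfl fun r hr => hz r <| by
        rw [← cell_eq_of_mem hq]
        exact cell_anti he (mem_halfCell.1 hr).1
    exact splitCount_mono (Int.fract_nonneg _) (Int.fract_lt_one _) _ ih (hm _).le (hm _)

/-- On a part of the tree with equal masses, no discrepancy is created. -/
lemma sum_abs_count_sub_of_eq (hD : ∀ q p, (∀ e < D, code q e = code p e) → q = p) (hd : d ≤ D)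
    (hz : ∀ q ∈ cell code d p, z q = z' q) :
    ∑ q ∈ cell code d p, |(nodeCount code z t D q : ℝ) - nodeCount code z' t D q| =
      |(nodeCount code z t d p : ℝ) - nodeCount code z' t d p| := by
  rw [← sum_count hD hd, ← sum_count hD hd, ← Finset.sum_sub_distrib]
  rcases le_total (nodeCount code z t d p) (nodeCount code z' t d p) with h | h
  · have hle : ∀ q ∈ cell code d p, (nodeCount code z t D q : ℝ) - nodeCount code z' t D q ≤ 0 :=
      fun q hq => sub_nonpos.2 (Int.cast_le.2 (nodeCount_mono_of_eq hz h hd hq))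
    rw [abs_of_nonpos (Finset.sum_nonpos hle), ← Finset.sum_neg_distrib]
    exact Finset.sum_congr rfl fun q hq => abs_of_nonpos (hle q hq)
  · have hle : ∀ q ∈ cell code d p, 0 ≤ (nodeCount code z t D q : ℝ) - nodeCount code z' t D q :=
      fun q hq => sub_nonneg.2 (Int.cast_le.2
        (nodeCount_mono_of_eq (fun q hq => (hz q hq).symm) h hd hq))
    rw [abs_of_nonneg (Finset.sum_nonneg hle)]
    exact Finset.sum_congr rfl fun q hq => abs_of_nonneg (hle q hq)

lemma halfMass_sibling (hz : ∀ q, q ∉ cell code d p → z q = z' q) (he : e < d) :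
    halfMass code z e p (!code p e) = halfMass code z' e p (!code p e) := by
  refine Finset.sum_congr rfl fun q hq => hz q fun hq' => ?_
  have h1 := mem_cell.1 hq' e he
  have h2 := (mem_halfCell.1 hq).2
  simp [h1] at h2

lemma cellMass_sub_of_le (hz : ∀ q, q ∉ cell code d p → z q = z' q) (he : e ≤ d) :
    cellMass code z' e p - cellMass code z e p = cellMass code z' d p - cellMass code z d p := by
  induction he using Nat.decreasingInduction with
  | self => rfl
  | of_succ e he ih =>
    rw [← ih, cellMass_succ, cellMass_succ, cellMass_eq z e p (code p e),
      cellMass_eq z' e p (code p e), halfMass_sibling hz he]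
    ring

lemma nodeCount_mono_path (hz : ∀ q, q ∉ cell code d p → z q = z' q)
    (hm : cellMass code z d p ≤ cellMass code z' d p) (he : e ≤ d) :
    nodeCount code z t e p ≤ nodeCount code z' t e p := by
  induction e with
  | zero =>
    have := cellMass_sub_of_le hz he
    rw [cellMass_zero, cellMass_zero] at this
    exact Int.ceil_le_ceil (by linarith)
  | succ e ih =>
    refine splitCount_mono (Int.fract_nonneg _) (Int.fract_lt_one _) _ (ih (by omega)) ?_
      (halfMass_sibling hz (by omega))
    rw [← cellMass_succ, ← cellMass_succ]
    linarith [cellMass_sub_of_le hz he]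

/-- The sibling cell is disjoint from the changed cell, so its masses agree and all its counts move
in the same direction: the changes add up to the one at its root. -/
lemma sum_abs_sibling_le (hD : ∀ q p, (∀ e < D, code q e = code p e) → q = p)
    (hz : ∀ q, q ∉ cell code d p → z q = z' q) (he : e < d) (heD : e < D) :
    ∑ q ∈ halfCell code e p (!code p e), |(nodeCount code z t D q : ℝ) - nodeCount code z' t D q| ≤
      |(halfCount code z t e p (!code p e) : ℝ) - halfCount code z' t e p (!code p e)| := by
  rcases (halfCell code e p (!code p e)).eq_empty_or_nonempty with h | ⟨r, hr⟩
  · rw [h, Finset.sum_empty]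
    exact abs_nonneg _
  · rw [← cell_succ_of_mem hr, sum_abs_count_sub_of_eq hD heD,
      nodeCount_eq_halfCount hr, nodeCount_eq_halfCount hr]
    intro q hq
    refine hz q fun hq' => ?_
    rw [cell_succ_of_mem hr, mem_halfCell, mem_cell.1 hq' e he] at hq
    simp at hq

/-- The sibling count is the parent count minus the count of the path child, and both of these
increase. -/
lemma abs_sibling_sub_le (hz : ∀ q, q ∉ cell code d p → z q = z' q)
    (hm : cellMass code z d p ≤ cellMass code z' d p) (he : e < d) :
    |(halfCount code z t e p (!code p e) : ℝ) - halfCount code z' t e p (!code p e)| ≤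
      ((nodeCount code z' t e p : ℝ) - nodeCount code z t e p) +
        ((nodeCount code z' t (e + 1) p : ℝ) - nodeCount code z t (e + 1) p) := by
  have m1 : (nodeCount code z t e p : ℝ) ≤ nodeCount code z' t e p :=
    Int.cast_le.2 (nodeCount_mono_path hz hm he.le)
  have m2 : (nodeCount code z t (e + 1) p : ℝ) ≤ nodeCount code z' t (e + 1) p :=
    Int.cast_le.2 (nodeCount_mono_path hz hm he)
  have a : ∀ z : Λ → ℝ, (nodeCount code z t (e + 1) p : ℝ) + halfCount code z t e p (!code p e) =
      nodeCount code z t e p := fun z => by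
    rw [nodeCount_succ, ← halfCount_add (code p e), Int.cast_add]
  have a1 := a z
  have a2 := a z'
  rw [abs_le]
  constructor <;> linarith

lemma halfCount_eq_zero {c : Bool} (h : halfMass code z d p c = 0) :
    halfCount code z t d p c = 0 := by
  have r := isRounding_halfCount (code := code) (z := z) (t := t) (d := d) (p := p) c
  rw [h] at r
  exact r.eq_zero

open Classical in
/-- The discrepancy created along a path of the tree. -/
lemma sum_abs_count_sub_le (hD : ∀ q p, (∀ e < D, code q e = code p e) → q = p) (hd : d ≤ D)
    (hz : ∀ q, q ∉ cell code d p → z q = z' q)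
    (hm : cellMass code z d p ≤ cellMass code z' d p) :
    ∑ q, |(nodeCount code z t D q : ℝ) - nodeCount code z' t D q| ≤
      ∑ e ∈ (Finset.range d).filter (fun e => halfMass code z e p (!code p e) ≠ 0),
        (((nodeCount code z' t e p : ℝ) - nodeCount code z t e p) +
          ((nodeCount code z' t (e + 1) p : ℝ) - nodeCount code z t (e + 1) p)) +
      ∑ q ∈ cell code d p, |(nodeCount code z t D q : ℝ) - nodeCount code z' t D q| := by
  have key : ∀ e ≤ d, ∑ q, |(nodeCount code z t D q : ℝ) - nodeCount code z' t D q| ≤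
      ∑ e ∈ (Finset.range e).filter (fun e => halfMass code z e p (!code p e) ≠ 0),
        (((nodeCount code z' t e p : ℝ) - nodeCount code z t e p) +
          ((nodeCount code z' t (e + 1) p : ℝ) - nodeCount code z t (e + 1) p)) +
      ∑ q ∈ cell code e p, |(nodeCount code z t D q : ℝ) - nodeCount code z' t D q| := by
    intro e
    induction e with
    | zero => simp [cell_zero]
    | succ e ih =>
      intro he
      refine (ih (by omega)).trans ?_
      rw [sum_cell _ e p (code p e), ← cell_succ, Finset.sum_filter, Finset.sum_filter,
        Finset.sum_range_succ]
      have h1 := sum_abs_sibling_le (t := t) hD hz he (by omega)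
      split_ifs with h
      · linarith [abs_sibling_sub_le (t := t) hz hm he]
      -- A sibling of mass 0 has count 0 for both vectors, so this level is free. This is what makes
      -- the depth of the tree harmless.
      · rw [not_not] at h
        rw [halfCount_eq_zero h, halfCount_eq_zero (halfMass_sibling hz he ▸ h)] at h1
        simp only [Int.cast_zero, sub_zero, abs_zero] at h1
        linarith
  exact key d le_rfl

lemma nodeCount_nonneg (hz : ∀ q, 0 ≤ z q) : 0 ≤ nodeCount code z t d p :=
  isRounding_count.nonneg (cellMass_nonneg hz)

lemma isRounding_count_leaf (hD : ∀ q p, (∀ e < D, code q e = code p e) → q = p) :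
    IsRounding (z p) (nodeCount code z t D p) := by
  have := isRounding_count (code := code) (z := z) (t := t) (d := D) (p := p)
  rwa [cellMass, cell_eq_singleton hD, Finset.sum_singleton] at this

/-- The crude bound, for the rare event that the concentrated mass of a cell jumps to another leaf.
-/
lemma sum_abs_count_sub_le_add (hD : ∀ q p, (∀ e < D, code q e = code p e) → q = p) (hd : d ≤ D)
    (hz : ∀ q, 0 ≤ z q) (hz' : ∀ q, 0 ≤ z' q) :
    ∑ q ∈ cell code d p, |(nodeCount code z t D q : ℝ) - nodeCount code z' t D q| ≤
      (nodeCount code z t d p : ℝ) + nodeCount code z' t d p := by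
  rw [← sum_count hD hd, ← sum_count hD hd, ← Finset.sum_add_distrib]
  refine Finset.sum_le_sum fun q _ => ?_
  have h1 : (0 : ℝ) ≤ nodeCount code z t D q := Int.cast_nonneg (nodeCount_nonneg hz)
  have h2 : (0 : ℝ) ≤ nodeCount code z' t D q := Int.cast_nonneg (nodeCount_nonneg hz')
  rw [abs_le]
  constructor <;> linarith

/-- Leaves of mass 0 have count 0, so the whole count of the cell sits on `r`. -/
lemma sum_abs_count_sub_of_single (hD : ∀ q p, (∀ e < D, code q e = code p e) → q = p)
    (hd : d ≤ D) (hr : r ∈ cell code d p) (hz : ∀ q ∈ cell code d p, q ≠ r → z q = 0)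
    (hz' : ∀ q ∈ cell code d p, q ≠ r → z' q = 0) :
    ∑ q ∈ cell code d p, |(nodeCount code z t D q : ℝ) - nodeCount code z' t D q| =
      |(nodeCount code z t d p : ℝ) - nodeCount code z' t d p| := by
  have h0 : ∀ {z : Λ → ℝ}, (∀ q ∈ cell code d p, q ≠ r → z q = 0) →
      ∀ q ∈ cell code d p, q ≠ r → (nodeCount code z t D q : ℝ) = 0 := by
    intro z hz q hq hqr
    have := isRounding_count_leaf (z := z) (t := t) (p := q) hD
    rw [hz q hq hqr] at this
    rw [this.eq_zero, Int.cast_zero]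
  rw [← sum_count hD hd, ← sum_count hD hd, Finset.sum_eq_single_of_mem r hr (h0 hz),
    Finset.sum_eq_single_of_mem r hr (h0 hz'), Finset.sum_eq_single_of_mem r hr]
  intro q hq hqr
  rw [h0 hz q hq hqr, h0 hz' q hq hqr, sub_zero, abs_zero]

end Tree

/-! ### The expected counts -/

/-- The uniform distribution on `[0, 1)`. -/
noncomputable def unif : Measure ℝ := volume.restrict (Set.Ico 0 1)

instance : IsProbabilityMeasure unif := ⟨by simp [unif]⟩

/-- The distribution of the seeds of the levels of a tree. -/
noncomputable def seeds : Measure (ℕ → ℝ) := Measure.infinitePi fun _ => unif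

instance : IsProbabilityMeasure seeds := by unfold seeds; infer_instance

lemma integral_unif_fract (g : ℝ → ℝ) : ∫ u, g (Int.fract u) ∂unif = ∫ u in (0 : ℝ)..1, g u := by
  rw [unif, intervalIntegral.integral_of_le zero_le_one, integral_Ico_eq_integral_Ioo,
    integral_Ioc_eq_integral_Ioo]
  refine setIntegral_congr_fun measurableSet_Ioo fun u hu => ?_
  rw [Int.fract_eq_self.2 ⟨hu.1.le, hu.2⟩]

lemma integral_seeds_eval (g : ℝ → ℝ) (hg : Measurable g) (i : ℕ) :
    ∫ t, g (t i) ∂seeds = ∫ u, g u ∂unif := by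
  have := measurePreserving_eval_infinitePi (fun _ : ℕ => unif) i
  rw [← this.map_eq, integral_map this.measurable.aemeasurable hg.aestronglyMeasurable]
  rfl

section Expectation

variable {Λ : Type*} [Fintype Λ] {code : Λ → ℕ → Bool} {z z' : Λ → ℝ} {t t' : ℕ → ℝ} {d D : ℕ}
  {p q : Λ}

lemma nodeCount_congr_seeds (h : ∀ e ≤ d, t e = t' e) : nodeCount code z t d p = nodeCount code z t' d p := by
  induction d with
  | zero => rw [nodeCount, nodeCount, h 0 le_rfl]
  | succ d ih =>
    rw [nodeCount, nodeCount, ih fun e he => h e (by omega), h (d + 1) le_rfl]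

lemma measurable_leftCount : Measurable fun x : ℝ × ℝ × ℤ × ℝ =>
    leftCount x.1 x.2.1 x.2.2.1 x.2.2.2 := by
  unfold leftCount resample
  have : Measurable fun x : ℝ × ℝ × ℤ × ℝ => (x.2.2.1 : ℝ) :=
    (measurable_of_countable (fun N : ℤ => (N : ℝ))).comp (by fun_prop)
  refine Int.measurable_ceil.comp ?_
  fun_prop

lemma measurable_cellMass : Measurable fun z : Λ → ℝ => cellMass code z d p := by
  unfold cellMass; fun_prop

lemma measurable_halfMass (c : Bool) : Measurable fun z : Λ → ℝ => halfMass code z d p c := by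
  unfold halfMass; fun_prop

lemma measurable_count : Measurable fun a : (Λ → ℝ) × (ℕ → ℝ) => nodeCount code a.1 a.2 d p := by
  induction d with
  | zero =>
    unfold nodeCount
    refine Int.measurable_ceil.comp (Measurable.sub (by fun_prop) ?_)
    exact measurable_fract.comp (by fun_prop)
  | succ d ih =>
    have h : Measurable fun a : (Λ → ℝ) × (ℕ → ℝ) => leftCount (cellMass code a.1 d p)
        (halfMass code a.1 d p false) (nodeCount code a.1 a.2 d p) (Int.fract (a.2 (d + 1))) := by
      refine measurable_leftCount.comp (Measurable.prodMk ?_ (Measurable.prodMk ?_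
        (Measurable.prodMk ih ?_)))
      · exact measurable_cellMass.comp measurable_fst
      · exact (measurable_halfMass _).comp measurable_fst
      · exact measurable_fract.comp (by fun_prop)
    unfold nodeCount splitCount
    cases code p d
    · simpa using h
    · simp only [if_true]
      exact ih.sub h

lemma measurable_count_seeds : Measurable fun t => (nodeCount code z t d p : ℝ) :=
  (measurable_of_countable (fun N : ℤ => (N : ℝ))).comp (measurable_count.comp
    (measurable_const.prodMk measurable_id))

lemma integrable_count : Integrable (fun t => (nodeCount code z t d p : ℝ)) seeds := by
  refine Integrable.of_bound measurable_count_seeds.aestronglyMeasurable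
    (|cellMass code z d p| + 1) (Filter.Eventually.of_forall fun t => ?_)
  obtain ⟨h1, h2⟩ := isRounding_count (code := code) (z := z) (t := t) (d := d) (p := p)
  rw [Real.norm_eq_abs, abs_le]
  constructor <;> linarith [neg_abs_le (cellMass code z d p), le_abs_self (cellMass code z d p)]

/-- The count at depth `d` is a function of the seeds `0, …, d`; in `φ` the later seeds are replaced
by 0. -/
lemma indepFun_count_seed :
    ProbabilityTheory.IndepFun (fun t : ℕ → ℝ => nodeCount code z t d p) (fun t => t (d + 1))
      seeds := by
  have h := ProbabilityTheory.iIndepFun_infinitePi (P := fun _ : ℕ => unif)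
    (X := fun _ x => x) (fun _ => measurable_id)
  have h2 := h.indepFun_finset (Finset.range (d + 1)) {d + 1} (by simp) (fun i => by fun_prop)
  have hext : ∀ i, Measurable fun r : (i : Finset.range (d + 1)) → ℝ =>
      if h : i ∈ Finset.range (d + 1) then r ⟨i, h⟩ else 0 := by
    intro i
    by_cases h : i ∈ Finset.range (d + 1)
    · simp only [h, dite_true]
      exact measurable_pi_apply _
    · simp only [h, dite_false]
      exact measurable_const
  let φ : ((i : Finset.range (d + 1)) → ℝ) → ℤ := fun r =>
    nodeCount code z (fun i => if h : i ∈ Finset.range (d + 1) then r ⟨i, h⟩ else 0) d p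
  have hφ : Measurable φ :=
    measurable_count.comp (measurable_const.prodMk (measurable_pi_lambda _ hext))
  have hlast : Measurable fun r : (i : ({d + 1} : Finset ℕ)) → ℝ =>
      r ⟨d + 1, Finset.mem_singleton_self _⟩ := measurable_pi_apply _
  have h3 := h2.comp hφ hlast
  have e : (fun t : ℕ → ℝ => nodeCount code z t d p) =
      φ ∘ fun t (i : Finset.range (d + 1)) => t i := by
    funext t
    refine nodeCount_congr_seeds fun e he => ?_
    simp [Nat.lt_succ_iff.2 he]
  rw [e]
  exact h3

/-- The count takes only the values `⌊s⌋` and `⌊s⌋ + 1`, so its mean determines its law. With an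
independent fresh seed the average is the one in `integral_leftCount`. -/
lemma integral_leftCount_count
    (h : ∫ t, (nodeCount code z t d p : ℝ) ∂seeds = cellMass code z d p) (a : ℝ) :
    ∫ t, (leftCount (cellMass code z d p) a (nodeCount code z t d p) (Int.fract (t (d + 1))) : ℝ)
      ∂seeds = a := by
  set s := cellMass code z d p with hs
  set ψ : ℤ → ℝ → ℝ := fun N u => leftCount s a N (Int.fract u) with hψ
  have hψm : ∀ N, Measurable (ψ N) := fun N =>
    (measurable_of_countable (fun N : ℤ => (N : ℝ))).comp (measurable_leftCount.comp
      (Measurable.prodMk measurable_const (Measurable.prodMk measurable_const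
        (Measurable.prodMk measurable_const measurable_fract))))
  set m := ⌊s⌋
  have hψb : ∀ N u, ‖ψ N u‖ ≤ |a| + |s| + |(N : ℝ)| + 5 := by
    intro N u
    have h0 := Int.fract_nonneg u
    have h1 := Int.fract_lt_one u
    have c1 := Int.le_ceil (a - resample s N (Int.fract u))
    have c2 := Int.ceil_lt_add_one (a - resample s N (Int.fract u))
    have c3 : |resample s N (Int.fract u)| ≤ |s| + |(N : ℝ)| + 1 + 1 := by
      unfold resample
      set f := Int.fract u
      have b1 : |max 0 (s - N)| ≤ |s| + |(N : ℝ)| + 1 := by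
        have := abs_sub s N
        rcases max_choice 0 (s - (N : ℝ)) with h | h <;> rw [h]
        · rw [abs_zero]; positivity
        · linarith
      have b2 : |min 1 (s - N + 1)| ≤ |s| + |(N : ℝ)| + 1 := by
        have := abs_sub s N
        have := abs_add_le (s - N) 1
        rcases min_choice 1 (s - (N : ℝ) + 1) with h | h <;> rw [h]
        · rw [abs_one]; linarith [abs_nonneg s, abs_nonneg (N : ℝ)]
        · rw [abs_one] at this; linarith
      have b3 := abs_add_le ((1 - f) * max 0 (s - N)) (f * min 1 (s - N + 1))
      rw [abs_mul, abs_mul, abs_of_nonneg h0, abs_of_nonneg (by linarith : 0 ≤ 1 - f)] at b3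
      nlinarith
    rw [Real.norm_eq_abs]
    simp only [hψ, leftCount]
    rw [abs_le] at c3 ⊢
    constructor <;> linarith [neg_abs_le a, le_abs_self a]
  have hψi : ∀ N, Integrable (fun t : ℕ → ℝ => ψ N (t (d + 1))) seeds := fun N =>
    Integrable.of_bound ((hψm N).comp (measurable_pi_apply _)).aestronglyMeasurable _
      (Filter.Eventually.of_forall fun t => hψb N _)
  have hE : ∀ N, ∫ t, ψ N (t (d + 1)) ∂seeds = ∫ u in (0 : ℝ)..1, (leftCount s a N u : ℝ) :=
    fun N => by
      rw [integral_seeds_eval _ (hψm N)]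
      exact integral_unif_fract fun u => (leftCount s a N u : ℝ)
  have hX : Integrable (fun t => (nodeCount code z t d p : ℝ) - m) seeds :=
    integrable_count.sub (integrable_const _)
  -- Interpolating linearly between the two possible counts replaces conditioning on the count by a
  -- product of independent factors.
  have hlin : ∀ t, (leftCount s a (nodeCount code z t d p) (Int.fract (t (d + 1))) : ℝ) =
      ψ m (t (d + 1)) +
        ((nodeCount code z t d p : ℝ) - m) * (ψ (m + 1) (t (d + 1)) - ψ m (t (d + 1))) := by
    intro t
    rcases (isRounding_count (code := code) (z := z) (t := t) (d := d) (p := p)).eq_floor_or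
      with h | h <;> rw [h, ← hs] <;> simp [hψ, m]
  have hind : ProbabilityTheory.IndepFun (fun t => (nodeCount code z t d p : ℝ) - m)
      (fun t => ψ (m + 1) (t (d + 1)) - ψ m (t (d + 1))) seeds :=
    indepFun_count_seed.comp (φ := fun N : ℤ => (N : ℝ) - m)
      (ψ := fun u => ψ (m + 1) u - ψ m u) (measurable_of_countable _)
      ((hψm _).sub (hψm _))
  simp_rw [hlin]
  have hprod : Integrable (fun t => ((nodeCount code z t d p : ℝ) - m) *
      (ψ (m + 1) (t (d + 1)) - ψ m (t (d + 1)))) seeds :=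
    hind.integrable_mul hX ((hψi _).sub (hψi _))
  rw [integral_add (hψi m) hprod]
  have := hind.integral_mul_eq_mul_integral hX.aestronglyMeasurable
    ((hψi (m + 1)).sub (hψi m)).aestronglyMeasurable
  simp only [Pi.mul_apply] at this
  rw [show ∫ t, ((nodeCount code z t d p : ℝ) - m) * (ψ (m + 1) (t (d + 1)) - ψ m (t (d + 1))) ∂seeds
    = _ from this, integral_sub integrable_count (integrable_const _),
    integral_sub (hψi _) (hψi _), hE, hE, h, integral_const]
  have hfin := integral_leftCount s a
  simp only [probReal_univ, one_smul]
  have hf : s - m = Int.fract s := rfl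
  rw [hf]
  linear_combination hfin

/-- The expected count of a node is its mass. -/
lemma integral_nodeCount : ∫ t, (nodeCount code z t d p : ℝ) ∂seeds = cellMass code z d p := by
  induction d with
  | zero =>
    rw [cellMass_zero]
    have hm : Measurable fun u : ℝ => ((⌈(∑ q, z q) - Int.fract u⌉ : ℤ) : ℝ) :=
      (measurable_of_countable (fun N : ℤ => (N : ℝ))).comp
        (Int.measurable_ceil.comp (measurable_const.sub measurable_fract))
    have h1 := integral_seeds_eval _ hm 0
    refine h1.trans ?_
    rw [integral_unif_fract fun u => ((⌈(∑ q, z q) - u⌉ : ℤ) : ℝ), integral_ceil_sub]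
  | succ d ih =>
    have h := integral_leftCount_count ih (halfMass code z d p false)
    rw [cellMass_succ]
    have hc : ∀ t, nodeCount code z t (d + 1) p =
      splitCount code z d p (nodeCount code z t d p) (Int.fract (t (d + 1))) (code p d) := fun t => rfl
    cases hb : code p d with
    | false =>
      rw [← h]
      refine integral_congr_ae (Filter.Eventually.of_forall fun t => ?_)
      simp [hc, splitCount, hb]
    | true =>
      have h2 : halfMass code z d p true = cellMass code z d p - halfMass code z d p false := by
        rw [cellMass_eq z d p false]
        simp
      have he : ∀ t, (leftCount (cellMass code z d p) (halfMass code z d p false)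
          (nodeCount code z t d p) (Int.fract (t (d + 1))) : ℝ) =
          (nodeCount code z t d p : ℝ) - nodeCount code z t (d + 1) p := by
        intro t
        rw [hc, splitCount, hb, if_pos rfl]
        push_cast
        ring
      simp_rw [he] at h
      rw [integral_sub integrable_count integrable_count, ih] at h
      linarith

open Classical in
/-- The expected discrepancy of the leaf counts of two mass vectors that differ below one node. -/
lemma integral_sum_abs_count_sub_le (hD : ∀ q p, (∀ e < D, code q e = code p e) → q = p)
    (hd : d ≤ D) (hz : ∀ q, q ∉ cell code d p → z q = z' q) {δ : ℝ} (hδ : 0 ≤ δ)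
    (hm : cellMass code z' d p = cellMass code z d p + δ) :
    ∫ t, ∑ q, |(nodeCount code z t D q : ℝ) - nodeCount code z' t D q| ∂seeds ≤
      2 * δ * ((Finset.range d).filter (fun e => halfMass code z e p (!code p e) ≠ 0)).card +
      ∫ t, ∑ q ∈ cell code d p, |(nodeCount code z t D q : ℝ) - nodeCount code z' t D q| ∂seeds := by
  have hi : ∀ q, Integrable (fun t => |(nodeCount code z t D q : ℝ) - nodeCount code z' t D q|) seeds :=
    fun q => (integrable_count.sub integrable_count).abs
  have hdiff : ∀ e, Integrable (fun t => (nodeCount code z' t e p : ℝ) - nodeCount code z t e p) seeds :=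
    fun e => integrable_count.sub integrable_count
  have hE : ∀ e ≤ d, ∫ t, (nodeCount code z' t e p : ℝ) - nodeCount code z t e p ∂seeds = δ := by
    intro e he
    rw [integral_sub integrable_count integrable_count, integral_nodeCount, integral_nodeCount,
      cellMass_sub_of_le hz he, hm]
    ring
  have hadd : ∀ e, Integrable (fun t =>
      ((nodeCount code z' t e p : ℝ) - nodeCount code z t e p) +
        ((nodeCount code z' t (e + 1) p : ℝ) - nodeCount code z t (e + 1) p)) seeds :=
    fun e => (hdiff e).add (hdiff (e + 1))
  refine (integral_mono (integrable_finsetSum _ fun q _ => hi q) ?_ fun t =>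
    sum_abs_count_sub_le (t := t) hD hd hz (by linarith)).trans ?_
  · exact (integrable_finsetSum _ fun e _ => hadd e).add
      (integrable_finsetSum _ fun q _ => hi q)
  · rw [integral_add (integrable_finsetSum _ fun e _ => hadd e)
      (integrable_finsetSum _ fun q _ => hi q), integral_finsetSum _ fun e _ => hadd e, Finset.sum_congr rfl (g := fun _ => 2 * δ)]
    · rw [Finset.sum_const, nsmul_eq_mul, mul_comm]
    · intro e he
      have he' := Finset.mem_range.1 (Finset.mem_filter.1 he).1
      rw [integral_add (hdiff e) (hdiff (e + 1)), hE e he'.le, hE (e + 1) he']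
      ring

lemma integral_cell_le_add (hD : ∀ q p, (∀ e < D, code q e = code p e) → q = p) (hd : d ≤ D)
    (hz : ∀ q, 0 ≤ z q) (hz' : ∀ q, 0 ≤ z' q) :
    ∫ t, ∑ q ∈ cell code d p, |(nodeCount code z t D q : ℝ) - nodeCount code z' t D q| ∂seeds ≤
      cellMass code z d p + cellMass code z' d p := by
  rw [← integral_nodeCount, ← integral_nodeCount, ← integral_add integrable_count integrable_count]
  exact integral_mono (integrable_finsetSum _ fun q _ =>
    (integrable_count.sub integrable_count).abs) (integrable_count.add integrable_count)
    fun t => sum_abs_count_sub_le_add hD hd hz hz'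

lemma integral_cell_of_single (hD : ∀ q p, (∀ e < D, code q e = code p e) → q = p) (hd : d ≤ D)
    (hzz : ∀ q, q ∉ cell code d p → z q = z' q) {δ : ℝ} (hδ : 0 ≤ δ)
    (hm : cellMass code z' d p = cellMass code z d p + δ) {r : Λ}
    (hr : r ∈ cell code d p) (hz : ∀ q ∈ cell code d p, q ≠ r → z q = 0)
    (hz' : ∀ q ∈ cell code d p, q ≠ r → z' q = 0) :
    ∫ t, ∑ q ∈ cell code d p, |(nodeCount code z t D q : ℝ) - nodeCount code z' t D q| ∂seeds = δ := by
  have : ∀ t, ∑ q ∈ cell code d p, |(nodeCount code z t D q : ℝ) - nodeCount code z' t D q| =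
      (nodeCount code z' t d p : ℝ) - nodeCount code z t d p := by
    intro t
    rw [sum_abs_count_sub_of_single hD hd hr hz hz', abs_sub_comm, abs_of_nonneg]
    exact sub_nonneg.2 (Int.cast_le.2 (nodeCount_mono_path hzz (by linarith) le_rfl))
  simp_rw [this]
  rw [integral_sub integrable_count integrable_count, integral_nodeCount, integral_nodeCount, hm]
  ring

end Expectation

/-! ### Correlated sampling of one element by exponential clocks -/

section Clocks

variable {ι : Type*} [Fintype ι]

instance : IsProbabilityMeasure (ProbabilityTheory.expMeasure 1) :=
  ProbabilityTheory.isProbabilityMeasure_expMeasure one_pos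

/-- The joint distribution of independent exponential clocks. -/
noncomputable def clocks (ι : Type*) [Fintype ι] : Measure (ι → ℝ) :=
  Measure.pi fun _ => ProbabilityTheory.expMeasure 1

instance : IsProbabilityMeasure (clocks ι) := by unfold clocks; infer_instance

/-- The ringing time of clock `i` at rate `W i`; ties are broken by an enumeration. -/
noncomputable def ringTime (W E : ι → ℝ) (i : ι) : ℝ ×ₗ Fin (Fintype.card ι) :=
  -- With the absolute value, raising a rate never delays its clock, even on the null set where `E
  -- i` is negative.
  toLex (|E i| / W i, Fintype.equivFin ι i)

/-- Clock `i` is the first one to ring if the clocks have rates `W`. -/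
def IsWinner (W E : ι → ℝ) (i : ι) : Prop :=
  0 < W i ∧ ∀ j, 0 < W j → ringTime W E i ≤ ringTime W E j

variable {W W' E : ι → ℝ} {i j : ι}

lemma ringTime_injective : Function.Injective (ringTime W E) := fun i j h => by
  simpa [ringTime] using congrArg (fun x => (ofLex x).2) h

lemma IsWinner.unique (hi : IsWinner W E i) (hj : IsWinner W E j) : i = j :=
  ringTime_injective (le_antisymm (hi.2 j hj.1) (hj.2 i hi.1))

lemma exists_isWinner (h : ∃ i, 0 < W i) : ∃ i, IsWinner W E i := by
  classical
  obtain ⟨i, hi, h⟩ := Finset.exists_min_image (Finset.univ.filter fun i => 0 < W i)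
    (ringTime W E) (h.imp fun i hi => by simpa using hi)
  exact ⟨i, (Finset.mem_filter.1 hi).2, fun j hj => h j (by simpa using hj)⟩

lemma ringTime_le_iff : ringTime W E i ≤ ringTime W E j ↔ |E i| / W i < |E j| / W j ∨
    |E i| / W i = |E j| / W j ∧ Fintype.equivFin ι i ≤ Fintype.equivFin ι j := by
  rw [Prod.Lex.le_iff]
  rfl

lemma measurableSet_isWinner : MeasurableSet {E | IsWinner W E i} := by
  unfold IsWinner
  simp only [ringTime_le_iff]
  rw [Set.ofPred_and, Set.ofPred_forall]
  refine (MeasurableSet.const _).inter ?_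
  refine MeasurableSet.iInter fun j => ?_
  rw [Set.ofPred_forall]
  refine MeasurableSet.iInter fun _ => ?_
  rw [Set.ofPred_or, Set.ofPred_and]
  refine (measurableSet_lt (by fun_prop) (by fun_prop)).union ?_
  exact (measurableSet_eq_fun (by fun_prop) (by fun_prop)).inter (MeasurableSet.const _)

lemma ringTime_le_of_le (hi : W i ≤ W' i) (h0 : 0 < W i) :
    ringTime W' E i ≤ ringTime W E i := by
  rw [ringTime, ringTime, Prod.Lex.toLex_le_toLex]
  have : |E i| / W' i ≤ |E i| / W i := div_le_div_of_nonneg_left (abs_nonneg _) h0 hi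
  rcases this.lt_or_eq with h | h
  · exact Or.inl h
  · exact Or.inr ⟨h, le_rfl⟩

lemma IsWinner.mono (h : ∀ j, j ≠ i → W' j = W j) (hi : W i ≤ W' i) (hw : IsWinner W E i) : IsWinner W' E i := by
  refine ⟨hw.1.trans_le hi, fun j hj => ?_⟩
  rcases eq_or_ne j i with rfl | hji
  · exact le_rfl
  · refine (ringTime_le_of_le hi hw.1).trans ((hw.2 j (h j hji ▸ hj)).trans_eq ?_)
    rw [ringTime, ringTime, h j hji]

/-- If the rate of clock `i` grows, only `i` can become a new winner. -/
lemma isWinner_of_ne (h : ∀ j, j ≠ i → W' j = W j) (hi : W i ≤ W' i) (hw : IsWinner W E j)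
    (hw' : ¬ IsWinner W' E j) : IsWinner W' E i := by
  have hji : j ≠ i := fun hji => hw' (by subst hji; exact hw.mono h hi)
  have hj : ringTime W' E j = ringTime W E j := by rw [ringTime, ringTime, h j hji]
  obtain ⟨r, hr⟩ := exists_isWinner (W := W') (E := E) ⟨j, (h j hji).symm ▸ hw.1⟩
  rcases eq_or_ne r i with rfl | hri
  · exact hr
  · have h1 : ringTime W' E r = ringTime W E r := by rw [ringTime, ringTime, h r hri]
    have h2 := hr.2 j ((h j hji).symm ▸ hw.1)
    have h3 := hw.2 r (h r hri ▸ hr.1)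
    rw [hj, h1] at h2
    have := ringTime_injective (le_antisymm h2 h3)
    exact absurd (this ▸ hr) hw'

/-! ### Law of the first clock to ring -/

lemma expMeasure_Ioi {c : ℝ} (hc : 0 ≤ c) :
    ProbabilityTheory.expMeasure 1 (Set.Ioi c) = ENNReal.ofReal (Real.exp (-c)) := by
  have h1 := ProbabilityTheory.cdf_expMeasure_eq one_pos c
  rw [ProbabilityTheory.cdf_eq_real, if_pos hc, one_mul] at h1
  rw [← ofReal_measureReal, ← Set.compl_Iic, probReal_compl_eq_one_sub measurableSet_Iic, h1]
  congr 1
  ring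

/-- The product of `e^{-cx}` and the density `e^{-x}` is `1 / (1 + c)` times the exponential density
of rate `1 + c`. -/
lemma lintegral_exp_expMeasure {c : ℝ} (hc : 0 ≤ c) :
    ∫⁻ x, (if 0 ≤ x then ENNReal.ofReal (Real.exp (-(c * x))) else 0)
      ∂(ProbabilityTheory.expMeasure 1) = ENNReal.ofReal (1 / (1 + c)) := by
  have hd : ProbabilityTheory.expMeasure 1 =
    volume.withDensity (ProbabilityTheory.exponentialPDF 1) := rfl
  have hmeas : ∀ r, Measurable (ProbabilityTheory.exponentialPDF r) := fun r =>
    (ProbabilityTheory.measurable_exponentialPDFReal r).ennreal_ofReal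
  rw [hd, lintegral_withDensity_eq_lintegral_mul _ (hmeas 1)]
  · have hpos : 0 < 1 + c := by linarith
    have : ∀ x, (ProbabilityTheory.exponentialPDF 1 * fun x =>
        if 0 ≤ x then ENNReal.ofReal (Real.exp (-(c * x))) else 0) x =
        ENNReal.ofReal (1 / (1 + c)) * ProbabilityTheory.exponentialPDF (1 + c) x := by
      intro x
      rw [Pi.mul_apply, ProbabilityTheory.exponentialPDF_eq, ProbabilityTheory.exponentialPDF_eq]
      split_ifs with hx
      · rw [← ENNReal.ofReal_mul (by positivity), ← ENNReal.ofReal_mul (by positivity)]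
        congr 1
        rw [← mul_assoc, one_div_mul_cancel hpos.ne', one_mul, one_mul, one_mul, ← Real.exp_add]
        congr 1
        ring
      · simp
    rw [lintegral_congr this, lintegral_const_mul _ (hmeas _),
      ProbabilityTheory.lintegral_exponentialPDF_eq_one hpos, mul_one]
  · exact Measurable.ite measurableSet_Ici (by fun_prop) measurable_const

/-- Given `E i = x ≥ 0`, the other clocks independently exceed `c j * x` with probabilities `e^{-c j
* x}`. Integrating the product over `x` gives the formula. -/
lemma clocks_forall_lt [DecidableEq ι] (i : ι) {c : ι → ℝ} (hc : ∀ j, 0 ≤ c j) :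
    clocks ι {E | 0 ≤ E i ∧ ∀ j, j ≠ i → c j * E i < E j} =
      ENNReal.ofReal (1 / (1 + ∑ j ∈ Finset.univ.erase i, c j)) := by
  have hind : ProbabilityTheory.iIndepFun (fun (i : ι) (E : ι → ℝ) => E i) (clocks ι) :=
    ProbabilityTheory.iIndepFun_pi (X := fun _ x => x) fun _ => aemeasurable_id
  have h2 := hind.indepFun_finset {i} (Finset.univ.erase i) (by simp) (fun i => by fun_prop)
  have hlast : Measurable fun r : (i : ({i} : Finset ι)) → ℝ =>
    r ⟨i, Finset.mem_singleton_self _⟩ := measurable_pi_apply _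
  have h3 := h2.comp hlast measurable_id
  set ν := (clocks ι).map fun (E : ι → ℝ) (j : Finset.univ.erase i) => E j with hν
  have hres : Measurable fun (E : ι → ℝ) (j : Finset.univ.erase i) => E j := by fun_prop
  have : IsProbabilityMeasure ν := Measure.isProbabilityMeasure_map hres.aemeasurable
  have hmap := (ProbabilityTheory.indepFun_iff_map_prod_eq_prod_map_map
    (hlast.comp (by fun_prop)).aemeasurable hres.aemeasurable).1 h3
  have hev : (clocks ι).map (fun E : ι → ℝ => E i) = ProbabilityTheory.expMeasure 1 :=
    (measurePreserving_eval (fun _ : ι => ProbabilityTheory.expMeasure 1) i).map_eq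
  set T : Set (ℝ × (Finset.univ.erase i → ℝ)) := {a | 0 ≤ a.1 ∧
    ∀ j : Finset.univ.erase i, c j * a.1 < a.2 j} with hT
  have hTm : MeasurableSet T := by
    rw [hT, Set.ofPred_and, Set.ofPred_forall]
    refine (measurableSet_le measurable_const measurable_fst).inter ?_
    exact MeasurableSet.iInter fun j => measurableSet_lt (by fun_prop) (by fun_prop)
  have hset : {E : ι → ℝ | 0 ≤ E i ∧ ∀ j, j ≠ i → c j * E i < E j} =
      (fun E : ι → ℝ => (E i, fun j : Finset.univ.erase i => E j)) ⁻¹' T := by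
    ext E
    simp [hT]
  have hmap' : (clocks ι).map (fun E : ι → ℝ => (E i, fun j : Finset.univ.erase i => E j)) =
      (ProbabilityTheory.expMeasure 1).prod ν := by
    rw [← hev]
    exact hmap
  rw [hset, ← Measure.map_apply (by fun_prop) hTm, hmap', Measure.prod_apply hTm,
    ← lintegral_exp_expMeasure (Finset.sum_nonneg fun j _ => hc j)]
  refine lintegral_congr fun x => ?_
  split_ifs with hx
  · have hpre : Prod.mk x ⁻¹' T = {r | ∀ j : Finset.univ.erase i, c j * x < r j} := by
      ext r
      simp [hT, hx]
    have hpi : (fun (E : ι → ℝ) (j : Finset.univ.erase i) => E j) ⁻¹'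
        {r | ∀ j : Finset.univ.erase i, c j * x < r j} =
        Set.univ.pi fun j => if j = i then Set.univ else Set.Ioi (c j * x) := by
      ext E
      simp only [Set.preimage_ofPred_eq, Set.mem_ofPred_eq, Subtype.forall, Finset.mem_erase,
        Finset.mem_univ, and_true, Set.mem_pi]
      simp only [Set.mem_univ, forall_const]
      refine forall_congr' fun j => ?_
      by_cases hj : j = i <;> simp [hj]
    have hm : MeasurableSet {r : Finset.univ.erase i → ℝ |
        ∀ j : Finset.univ.erase i, c j * x < r j} := by
      rw [Set.ofPred_forall]
      exact MeasurableSet.iInter fun j => measurableSet_lt (by fun_prop) (by fun_prop)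
    rw [hpre, hν, Measure.map_apply hres hm, hpi, clocks, Measure.pi_pi, Finset.sum_mul,
      ← Finset.sum_neg_distrib, Real.exp_sum, ENNReal.ofReal_prod_of_nonneg
      fun j _ => (Real.exp_pos _).le, ← Finset.mul_prod_erase _ _ (Finset.mem_univ i), if_pos rfl, measure_univ, one_mul]
    refine Finset.prod_congr rfl fun j hj => ?_
    rw [if_neg (Finset.ne_of_mem_erase hj), expMeasure_Ioi (mul_nonneg (hc j) hx)]
  · have hpre : Prod.mk x ⁻¹' T = ∅ := by
      ext r
      simp [hT, hx]
    rw [hpre, measure_empty]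

/-- Only strict wins are counted, with `c j = W j / W i`; no statement about the probability of ties
is needed. -/
lemma le_clocks_isWinner (hW : ∀ j, 0 ≤ W j) (i : ι) :
    W i / ∑ j, W j ≤ (clocks ι).real {E | IsWinner W E i} := by
  classical
  rcases (hW i).eq_or_lt with h0 | h0
  · rw [← h0, zero_div]
    exact measureReal_nonneg
  · have h1 := clocks_forall_lt i (c := fun j => W j / W i) fun j => div_nonneg (hW j) h0.le
    have h2 : 1 / (1 + ∑ j ∈ Finset.univ.erase i, W j / W i) = W i / ∑ j, W j := by
      rw [← Finset.add_sum_erase _ _ (Finset.mem_univ i), ← Finset.sum_div]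
      have : 0 ≤ ∑ j ∈ Finset.univ.erase i, W j := Finset.sum_nonneg fun j _ => hW j
      field_simp
    rw [h2] at h1
    have h3 := congrArg ENNReal.toReal h1
    rw [ENNReal.toReal_ofReal (div_nonneg h0.le (Finset.sum_nonneg fun j _ => hW j))] at h3
    rw [← h3]
    refine measureReal_mono fun E hE => ⟨h0, fun j hj => ?_⟩
    rcases eq_or_ne j i with rfl | hji
    · exact le_rfl
    · refine ringTime_le_iff.2 (Or.inl ?_)
      have := hE.2 j hji
      rw [abs_of_nonneg hE.1, div_lt_div_iff₀ h0 hj]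
      rw [div_mul_eq_mul_div, div_lt_iff₀ h0] at this
      nlinarith [le_abs_self (E j)]

/-- Each clock rings first with probability proportional to its rate. -/
lemma clocks_isWinner (hW : ∀ j, 0 ≤ W j) (hs : 0 < ∑ j, W j) (i : ι) :
    (clocks ι).real {E | IsWinner W E i} = W i / ∑ j, W j := by
  classical
  have h1 : ∑ i, (clocks ι).real {E | IsWinner W E i} ≤ ∑ i, W i / ∑ j, W j := by
    rw [← Finset.sum_div, div_self hs.ne', ← measureReal_biUnion_finset _ fun i _ =>
      measurableSet_isWinner]
    · exact measureReal_le_one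
    · intro i _ j _ hij
      exact Set.disjoint_left.2 fun E hi hj => hij (IsWinner.unique hi hj)
  -- The winning events are disjoint and the lower bounds sum to 1, so every lower bound is
  -- attained.
  have h2 := (Finset.sum_eq_sum_iff_of_le fun i _ => le_clocks_isWinner hW i).1
    (le_antisymm (Finset.sum_le_sum fun i _ => le_clocks_isWinner hW i) h1)
  exact (h2 i (Finset.mem_univ i)).symm

/-- Correlation of the winners for two rate vectors that differ in one coordinate. -/
lemma clocks_isWinner_ne_le (hW : ∀ j, 0 ≤ W j) (hs : 0 < ∑ j, W j)
    (h : ∀ j, j ≠ i → W' j = W j) {δ : ℝ} (hδ : 0 ≤ δ) (hi : W' i = W i + δ) :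
    (clocks ι).real {E | ∃ j, IsWinner W E j ∧ ¬ IsWinner W' E j} ≤ δ / ∑ j, W' j := by
  classical
  have hle : W i ≤ W' i := by linarith
  have hW' : ∀ j, 0 ≤ W' j := fun j => by
    rcases eq_or_ne j i with rfl | hji
    · linarith [hW j]
    · rw [h j hji]; exact hW j
  have hsum : ∑ j, W' j = ∑ j, W j + δ := by
    rw [← Finset.add_sum_erase _ W (Finset.mem_univ i),
      ← Finset.add_sum_erase _ W' (Finset.mem_univ i), hi,
      Finset.sum_congr rfl fun j hj => h j (Finset.ne_of_mem_erase hj)]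
    ring
  -- A lost win can only go to `i`. With `S = ∑ j, W j` the probability is thus at most `(W i + δ) /
  -- (S + δ) - W i / S ≤ δ / (S + δ)`.
  have hsub : {E | ∃ j, IsWinner W E j ∧ ¬ IsWinner W' E j} ⊆
      {E | IsWinner W' E i} \ {E | IsWinner W E i} := by
    rintro E ⟨j, hj, hj'⟩
    refine ⟨isWinner_of_ne h hle hj hj', fun hw => hj' ?_⟩
    rw [hj.unique hw]
    exact IsWinner.mono h hle hw
  refine (measureReal_mono hsub).trans ?_
  rw [measureReal_sdiff (show {E | IsWinner W E i} ⊆ {E | IsWinner W' E i} from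
      fun E hE => IsWinner.mono h hle hE) measurableSet_isWinner,
    clocks_isWinner hW hs, clocks_isWinner hW' (by linarith), hi, hsum, add_div]
  have : W i / (∑ j, W j + δ) ≤ W i / ∑ j, W j :=
    div_le_div_of_nonneg_left (hW i) hs (by linarith)
  linarith

end Clocks

/-! ### Concentrating the mass of light nodes in one leaf -/

section Collapse

variable {ι : Type*} [Fintype ι] (code : ι → ℕ → Bool)

/-- The depth of the topmost ancestor of `i` whose mass is at most `τ`. -/
noncomputable def lightDepth (y : ι → ℝ) (τ : ℝ) (i : ι) : ℕ := sInf {d | cellMass code y d i ≤ τ}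

open Classical in
/-- The masses of the leaves below the depth-`d` ancestor of `i`. -/
noncomputable def cellRates (y : ι → ℝ) (d : ℕ) (i : ι) : ι → ℝ := fun j =>
  if j ∈ cell code d i then y j else 0

open Classical in
/-- The mass of each topmost node of mass at most `τ` is moved to the leaf whose clock rings
first. -/
noncomputable def concentrate (y : ι → ℝ) (τ : ℝ) (E : ι → ℝ) (i : ι) : ℝ :=
  if IsWinner (cellRates code y (lightDepth code y τ i) i) E i then
    cellMass code y (lightDepth code y τ i) i else 0

variable {code} {y y' : ι → ℝ} {τ : ℝ} {E : ι → ℝ} {i j : ι} {d D : ℕ}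

lemma sum_cellRates : ∑ j, cellRates code y d i j = cellMass code y d i := by
  simp [cellRates, cellMass]

lemma cellRates_congr (h : j ∈ cell code d i) : cellRates code y d j = cellRates code y d i := by
  unfold cellRates
  rw [cell_eq_of_mem h]

lemma cellRates_nonneg (hy0 : ∀ i, 0 ≤ y i) : 0 ≤ cellRates code y d i j := by
  unfold cellRates
  split_ifs
  exacts [hy0 j, le_rfl]

lemma cellRates_self : cellRates code y d i i = y i := if_pos self_mem_cell

lemma IsWinner.mem_cell (h : IsWinner (cellRates code y d i) E j) : j ∈ cell code d i := by
  by_contra hj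
  have := h.1
  rw [cellRates, if_neg hj] at this
  exact this.false

section

variable (hD : ∀ q p, (∀ e < D, code q e = code p e) → q = p) (hy : ∀ i, y i ≤ τ)
include hD hy

lemma cellMass_leaf_le : cellMass code y D i ≤ τ := by
  rw [cellMass, cell_eq_singleton hD, Finset.sum_singleton]
  exact hy i

lemma cellMass_lightDepth_le : cellMass code y (lightDepth code y τ i) i ≤ τ :=
  Nat.sInf_mem (s := {d | cellMass code y d i ≤ τ}) ⟨D, cellMass_leaf_le hD hy⟩

lemma lightDepth_le : lightDepth code y τ i ≤ D :=
  Nat.sInf_le (show D ∈ {d | cellMass code y d i ≤ τ} from cellMass_leaf_le hD hy)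

end

lemma lt_cellMass (h : d < lightDepth code y τ i) : τ < cellMass code y d i :=
  not_le.1 fun hle => Nat.notMem_of_lt_sInf h hle

lemma lightDepth_le_of (h : cellMass code y d i ≤ τ) : lightDepth code y τ i ≤ d :=
  Nat.sInf_le (show d ∈ {d | cellMass code y d i ≤ τ} from h)

/-- All leaves below a topmost light node have this node as their topmost light ancestor, because a
higher light ancestor of one would also lie above the other. So these nodes partition the leaves. -/
lemma lightDepth_congr (hD : ∀ q p, (∀ e < D, code q e = code p e) → q = p)
    (hy : ∀ i, y i ≤ τ) (h : j ∈ cell code (lightDepth code y τ i) i) :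
    lightDepth code y τ j = lightDepth code y τ i := by
  have h1 : lightDepth code y τ j ≤ lightDepth code y τ i := by
    refine lightDepth_le_of ?_
    rw [cellMass_congr h]
    exact cellMass_lightDepth_le hD hy
  refine le_antisymm h1 (lightDepth_le_of ?_)
  rw [← cellMass_congr (cell_anti h1 h)]
  exact cellMass_lightDepth_le hD hy

lemma concentrate_nonneg (hy0 : ∀ i, 0 ≤ y i) : 0 ≤ concentrate code y τ E i := by
  unfold concentrate
  split_ifs
  exacts [cellMass_nonneg hy0, le_rfl]

lemma concentrate_le (hD : ∀ q p, (∀ e < D, code q e = code p e) → q = p) (hy0 : ∀ i, 0 ≤ y i)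
    (hy : ∀ i, y i ≤ τ) : concentrate code y τ E i ≤ τ := by
  unfold concentrate
  split_ifs
  exacts [cellMass_lightDepth_le hD hy, (hy0 i).trans (hy i)]

lemma concentrate_eq_zero (h : y i = 0) : concentrate code y τ E i = 0 :=
  if_neg fun hw => by
    have := hw.1
    rw [cellRates_self, h] at this
    exact this.false

lemma isWinner_of_concentrate_ne_zero (h : concentrate code y τ E i ≠ 0) :
    IsWinner (cellRates code y (lightDepth code y τ i) i) E i := by
  by_contra hw
  exact h (if_neg hw)

/-- Each topmost light cell of positive mass has exactly one winner, which takes all of it; higher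
nodes follow by adding their children. Below the light depth the identity fails, since the mass may
sit in another subcell. -/
lemma sum_concentrate (hD : ∀ q p, (∀ e < D, code q e = code p e) → q = p) (hy0 : ∀ i, 0 ≤ y i)
    (hy : ∀ i, y i ≤ τ) (hd : d ≤ lightDepth code y τ i) :
    ∑ j ∈ cell code d i, concentrate code y τ E j = cellMass code y d i := by
  classical
  have key : ∀ d ≤ D, ∀ i, d ≤ lightDepth code y τ i →
      ∑ j ∈ cell code d i, concentrate code y τ E j = cellMass code y d i := by
    intro d hdD
    induction hdD using Nat.decreasingInduction with
    | self =>
      intro i hi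
      have he : D = lightDepth code y τ i := le_antisymm hi (lightDepth_le hD hy)
      rw [cell_eq_singleton hD, Finset.sum_singleton, concentrate, ← he]
      split_ifs with h
      · rfl
      · have hc : cellMass code y D i = y i := by
          rw [cellMass, cell_eq_singleton hD, Finset.sum_singleton]
        rw [hc]
        by_contra hne
        have h0 : 0 < y i := lt_of_le_of_ne (hy0 i) hne
        refine h ⟨by rwa [cellRates_self], fun j hj => ?_⟩
        have : j = i := by
          by_contra hji
          rw [cellRates, if_neg (by simpa [cell_eq_singleton hD] using hji)] at hj
          exact hj.false
        rw [this]
    | of_succ d hdD ih =>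
      intro i hi
      rcases hi.eq_or_lt with he | hlt
      · rcases (cellMass_nonneg hy0 : 0 ≤ cellMass code y d i).eq_or_lt with h0 | h0
        · rw [← h0]
          refine Finset.sum_eq_zero fun j hj => concentrate_eq_zero ?_
          exact (Finset.sum_eq_zero_iff_of_nonneg fun j _ => hy0 j).1 h0.symm j hj
        · obtain ⟨r, hr⟩ : ∃ r, IsWinner (cellRates code y d i) E r := by
            refine exists_isWinner ?_
            by_contra! hall
            rw [← sum_cellRates] at h0
            exact absurd (Finset.sum_nonpos fun j _ => hall j) (not_le.2 h0)
          have hval : ∀ j ∈ cell code d i, concentrate code y τ E j =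
              if IsWinner (cellRates code y d i) E j then cellMass code y d i else 0 := by
            intro j hj
            have hj' : lightDepth code y τ j = d := by
              rw [he] at hj ⊢
              exact lightDepth_congr hD hy hj
            rw [concentrate, hj', cellRates_congr hj, cellMass_congr hj]
          rw [Finset.sum_congr rfl hval, Finset.sum_eq_single_of_mem r hr.mem_cell, if_pos hr]
          intro j _ hjr
          exact if_neg fun hw => hjr (hw.unique hr)
      · rw [sum_cell _ d i false, cellMass_eq y d i false]
        have hhalf : ∀ c, ∑ j ∈ halfCell code d i c, concentrate code y τ E j =
            halfMass code y d i c := by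
          intro c
          rcases (halfCell code d i c).eq_empty_or_nonempty with h | ⟨r, hr⟩
          · rw [halfMass, h, Finset.sum_empty, Finset.sum_empty]
          · rw [← cell_succ_of_mem hr, ih r, cellMass, cell_succ_of_mem hr, halfMass]
            have hr' := (mem_halfCell.1 hr).1
            by_contra! hlt'
            have h1 := cellMass_lightDepth_le hD hy (i := r)
            rw [cellMass_congr (cell_anti (by omega) hr')] at h1
            have := lightDepth_le_of h1
            omega
        rw [hhalf, hhalf]
  exact key d (hd.trans (lightDepth_le hD hy)) i hd

lemma sum_univ_concentrate [Nonempty ι] (hD : ∀ q p, (∀ e < D, code q e = code p e) → q = p)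
    (hy0 : ∀ i, 0 ≤ y i) (hy : ∀ i, y i ≤ τ) :
    ∑ j, concentrate code y τ E j = ∑ j, y j := by
  obtain ⟨i⟩ := ‹Nonempty ι›
  have := sum_concentrate (E := E) hD hy0 hy (Nat.zero_le (lightDepth code y τ i))
  rwa [cell_zero, cellMass_zero] at this

/-- The expected concentrated mass of a leaf is its mass. -/
lemma integral_concentrate (hy0 : ∀ i, 0 ≤ y i) :
    ∫ E, concentrate code y τ E i ∂(clocks ι) = y i := by
  classical
  set d := lightDepth code y τ i with hd
  have h1 : (fun E => concentrate code y τ E i) =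
      Set.indicator {E | IsWinner (cellRates code y d i) E i} fun _ => cellMass code y d i := by
    funext E
    simp only [concentrate, Set.indicator, Set.mem_ofPred_eq, ← hd]
  rw [h1, integral_indicator_const _ measurableSet_isWinner]
  rcases (cellMass_nonneg hy0 : 0 ≤ cellMass code y d i).eq_or_lt with h0 | h0
  · rw [← h0, smul_zero]
    exact ((Finset.sum_eq_zero_iff_of_nonneg fun j _ => hy0 j).1 h0.symm i self_mem_cell).symm
  · rw [clocks_isWinner (fun j => cellRates_nonneg hy0) (by rwa [sum_cellRates]), sum_cellRates,
      cellRates_self, smul_eq_mul, div_mul_cancel₀ _ h0.ne']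

lemma measurable_lightDepth : Measurable fun τ => lightDepth code y τ i := by
  have hle : ∀ d, MeasurableSet {τ | ∃ e ≤ d, cellMass code y e i ≤ τ} := by
    intro d
    have : {τ | ∃ e ≤ d, cellMass code y e i ≤ τ} =
        ⋃ e ∈ Set.Iic d, Set.Ici (cellMass code y e i) := by
      ext τ; simp
    rw [this]
    exact MeasurableSet.biUnion (Set.to_countable _) fun e _ => measurableSet_Ici
  have hne : MeasurableSet {τ | ∃ e, cellMass code y e i ≤ τ} := by
    rw [Set.ofPred_exists]
    exact MeasurableSet.iUnion fun e => measurableSet_Ici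
  refine measurable_of_Iic fun d => ?_
  -- If no ancestor is light, the depth is `sInf ∅ = 0`, which accounts for the second set.
  have : (fun τ => lightDepth code y τ i) ⁻¹' Set.Iic d =
      {τ | ∃ e ≤ d, cellMass code y e i ≤ τ} ∪ {τ | ∃ e, cellMass code y e i ≤ τ}ᶜ := by
    ext τ
    simp only [Set.mem_preimage, Set.mem_Iic, Set.mem_union, Set.mem_ofPred_eq, Set.mem_compl_iff]
    constructor
    · intro hd
      by_cases h : ∃ e, cellMass code y e i ≤ τ
      · exact Or.inl ⟨_, hd, Nat.sInf_mem (s := {d | cellMass code y d i ≤ τ}) h⟩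
      · exact Or.inr h
    · rintro (⟨e, he, he'⟩ | h)
      · exact (lightDepth_le_of he').trans he
      · have : {d | cellMass code y d i ≤ τ} = ∅ :=
          Set.eq_empty_of_forall_notMem fun e he => h ⟨e, he⟩
        rw [lightDepth, this, Nat.sInf_empty]
        exact Nat.zero_le d
  rw [this]
  exact (hle d).union hne.compl

lemma measurable_concentrate :
    Measurable fun a : ℝ × (ι → ℝ) => concentrate code y a.1 a.2 i := by
  classical
  have hunc : Measurable fun a : ℕ × (ι → ℝ) =>
      if IsWinner (cellRates code y a.1 i) a.2 i then cellMass code y a.1 i else 0 :=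
    measurable_from_prod_countable_right fun d =>
      show Measurable fun E => if IsWinner (cellRates code y d i) E i then cellMass code y d i
        else 0 from Measurable.ite measurableSet_isWinner measurable_const measurable_const
  have hpair : Measurable fun a : ℝ × (ι → ℝ) => (lightDepth code y a.1 i, a.2) :=
    (measurable_lightDepth.comp measurable_fst).prodMk measurable_snd
  have heq : (fun a : ℝ × (ι → ℝ) => concentrate code y a.1 a.2 i) =
      (fun a : ℕ × (ι → ℝ) => if IsWinner (cellRates code y a.1 i) a.2 i then
        cellMass code y a.1 i else 0) ∘ fun a : ℝ × (ι → ℝ) => (lightDepth code y a.1 i, a.2) := by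
    funext a
    simp only [concentrate, Function.comp_apply]
  rw [heq]
  exact hunc.comp hpair

/-! ### Dependence of the concentration on one entry -/

lemma cellMass_eq_of_notMem (h : ∀ j, j ≠ i → y' j = y j) (hj : i ∉ cell code d j) :
    cellMass code y' d j = cellMass code y d j :=
  Finset.sum_congr rfl fun r hr => h r fun hri => hj (hri ▸ hr)

lemma cellMass_add_of_mem (h : ∀ j, j ≠ i → y' j = y j) {δ : ℝ} (hi : y' i = y i + δ)
    (hj : i ∈ cell code d j) : cellMass code y' d j = cellMass code y d j + δ := by
  classical
  rw [cellMass, cellMass, ← Finset.add_sum_erase _ y hj, ← Finset.add_sum_erase _ y' hj, hi,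
    Finset.sum_congr rfl fun r hr => h r (Finset.ne_of_mem_erase hr)]
  ring

lemma lightDepth_mono (hD : ∀ q p, (∀ e < D, code q e = code p e) → q = p)
    (h : ∀ j, j ≠ i → y' j = y j) {δ : ℝ} (hδ : 0 ≤ δ) (hi : y' i = y i + δ)
    (hy' : ∀ i, y' i ≤ τ) : lightDepth code y τ i ≤ lightDepth code y' τ i := by
  refine lightDepth_le_of ?_
  have h1 := cellMass_lightDepth_le hD hy' (i := i)
  rw [cellMass_add_of_mem h hi self_mem_cell] at h1
  linarith

/-- Changing the mass of `i` affects the concentration only below the topmost light ancestor of `i`. -/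
lemma concentrate_eq_of_notMem (hD : ∀ q p, (∀ e < D, code q e = code p e) → q = p)
    (h : ∀ j, j ≠ i → y' j = y j) {δ : ℝ} (hδ : 0 ≤ δ) (hi : y' i = y i + δ)
    (hy : ∀ i, y i ≤ τ) (hj : j ∉ cell code (lightDepth code y τ i) i) :
    concentrate code y τ E j = concentrate code y' τ E j := by
  -- A common ancestor of `i` and `j` lies strictly above the light node of `i`, so it is heavier
  -- than `τ` before and after the change; the other ancestors of `j` do not see `i`.
  have hiff : ∀ d, cellMass code y d j ≤ τ ↔ cellMass code y' d j ≤ τ := by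
    intro d
    by_cases hd : i ∈ cell code d j
    · have h1 : d < lightDepth code y τ i := by
        by_contra! hle
        exact hj (cell_anti hle (mem_cell_comm.1 hd))
      have h2 := lt_cellMass h1
      rw [cellMass_congr hd] at h2
      have h3 := cellMass_add_of_mem h hi hd
      constructor <;> intro <;> linarith
    · rw [cellMass_eq_of_notMem h hd]
  have hdepth : lightDepth code y τ j = lightDepth code y' τ j := by
    unfold lightDepth
    congr 1
    ext d
    exact hiff d
  have hnot : i ∉ cell code (lightDepth code y τ j) j := fun hmem => by
    have h1 : lightDepth code y τ j < lightDepth code y τ i := by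
      by_contra! hle
      exact hj (cell_anti hle (mem_cell_comm.1 hmem))
    have h2 := lt_cellMass h1
    rw [cellMass_congr hmem] at h2
    exact absurd (cellMass_lightDepth_le hD hy (i := j)) (not_le.2 h2)
  have hrates : cellRates code y (lightDepth code y τ j) j =
      cellRates code y' (lightDepth code y τ j) j := by
    funext r
    unfold cellRates
    split_ifs with hr
    · exact (h r fun hri => hnot (hri ▸ hr)).symm
    · rfl
  rw [concentrate, concentrate, ← hdepth, hrates, cellMass_eq_of_notMem h hnot]

end Collapse

/-! ### Changing one coordinate -/

section OneCoordinate

variable {ι : Type*} (code : ι → ℕ → Bool)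

/-- Codes for two copies of the leaves: the first bit selects the copy. -/
def pairCode : Bool × ι → ℕ → Bool
  | q, 0 => q.1
  | q, d + 1 => code q.2 d

lemma pairCode_injective {code : ι → ℕ → Bool} {D : ℕ}
    (hD : ∀ q p, (∀ e < D, code q e = code p e) → q = p) (q p : Bool × ι)
    (h : ∀ e < D + 1, pairCode code q e = pairCode code p e) : q = p :=
  Prod.ext (h 0 (by omega)) (hD _ _ fun e he => h (e + 1) (by omega))

variable [Fintype ι]

/-- The mass vector of the tree: heavy entries (first bit `false`) are kept and light entries are
concentrated. -/
noncomputable def treeMass (z : Bool × ι → ℝ) (τ : ℝ) (E : ι → ℝ) (q : Bool × ι) : ℝ :=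
  if q.1 then concentrate code (fun j => z (true, j)) τ E q.2 else z q

/-- The expected `ℓ₁`-distance of the leaf counts for two mass vectors. -/
noncomputable def discrepancy (D : ℕ) (z z' : Bool × ι → ℝ) : ℝ :=
  ∫ t, ∑ q, |(nodeCount (pairCode code) z t D q : ℝ) - nodeCount (pairCode code) z' t D q| ∂seeds

variable {code} {z z' : Bool × ι → ℝ} {i j : ι} {d D : ℕ} {b : Bool} {τ δ : ℝ} {E : ι → ℝ}

lemma mem_cell_pairCode {q : Bool × ι} :
    q ∈ cell (pairCode code) (d + 1) (b, i) ↔ q.1 = b ∧ q.2 ∈ cell code d i := by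
  rw [mem_cell, mem_cell]
  constructor
  · exact fun h => ⟨h 0 (by omega), fun e he => h (e + 1) (by omega)⟩
  · rintro ⟨h1, h2⟩ (_ | e) he
    · exact h1
    · exact h2 e (by omega)

lemma sum_cell_pairCode (f : Bool × ι → ℝ) :
    ∑ q ∈ cell (pairCode code) (d + 1) (b, i), f q = ∑ j ∈ cell code d i, f (b, j) := by
  symm
  refine Finset.sum_bij (fun j _ => (b, j)) (fun j hj => mem_cell_pairCode.2 ⟨rfl, hj⟩)
    (fun _ _ _ _ h => (Prod.ext_iff.1 h).2) (fun q hq => ?_) fun _ _ => rfl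
  obtain ⟨h1, h2⟩ := mem_cell_pairCode.1 hq
  exact ⟨q.2, h2, by rw [← h1]⟩

lemma exists_of_halfMass_ne_zero
    (h : halfMass (pairCode code) z (d + 1) (b, i) (!code i d) ≠ 0) :
    ∃ j ∈ cell code d i, j ≠ i ∧ z (b, j) ≠ 0 := by
  obtain ⟨q, hq, hqz⟩ := Finset.exists_ne_zero_of_sum_ne_zero h
  rw [mem_halfCell, mem_cell_pairCode] at hq
  obtain ⟨⟨h1, h2⟩, h3⟩ := hq
  refine ⟨q.2, h2, fun hji => ?_, by rwa [← h1]⟩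
  rw [pairCode, hji] at h3
  simp at h3

lemma treeMass_nonneg (hz : ∀ q, 0 ≤ z q) (q : Bool × ι) : 0 ≤ treeMass code z τ E q := by
  unfold treeMass
  split_ifs
  exacts [concentrate_nonneg fun j => hz _, hz q]

open Classical in
/-- The effect of changing a heavy coordinate. -/
lemma discrepancy_heavy_le (hD : ∀ q p, (∀ e < D, code q e = code p e) → q = p) (hδ : 0 ≤ δ)
    (h : ∀ q, q ≠ (false, i) → z' q = z q) (hi : z' (false, i) = z (false, i) + δ) :
    discrepancy code (D + 1) (treeMass code z τ E) (treeMass code z' τ E) ≤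
      δ * (2 * ((Finset.range D).filter fun e =>
        ∃ j ∈ cell code e i, j ≠ i ∧ z (false, j) ≠ 0).card + 3) := by
  have hinj := pairCode_injective hD
  have hlight : (fun j => z' (true, j)) = fun j => z (true, j) :=
    funext fun j => h _ (by simp)
  have hz : ∀ q, q ∉ cell (pairCode code) (D + 1) (false, i) →
      treeMass code z τ E q = treeMass code z' τ E q := by
    intro q hq
    rw [cell_eq_singleton hinj, Finset.mem_singleton] at hq
    rw [treeMass, treeMass, hlight, h q hq]
  have hm : cellMass (pairCode code) (treeMass code z' τ E) (D + 1) (false, i) =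
      cellMass (pairCode code) (treeMass code z τ E) (D + 1) (false, i) + δ := by
    rw [cellMass, cellMass, cell_eq_singleton hinj, Finset.sum_singleton, Finset.sum_singleton]
    simpa [treeMass] using hi
  have h1 := integral_sum_abs_count_sub_le hinj le_rfl hz hδ hm
  rw [integral_cell_of_single hinj le_rfl hz hδ hm self_mem_cell] at h1
  · refine h1.trans ?_
    -- The extra level is the root, where the sibling is the light copy. The total is `2 * δ * (card
    -- + 1)` along the path plus `δ` at the leaf itself.
    have hcard : ((Finset.range (D + 1)).filter fun e =>
        halfMass (pairCode code) (treeMass code z τ E) e (false, i)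
          (!pairCode code (false, i) e) ≠ 0).card ≤ ((Finset.range D).filter fun e =>
        ∃ j ∈ cell code e i, j ≠ i ∧ z (false, j) ≠ 0).card + 1 := by
      rw [← Finset.card_map (s := (Finset.range D).filter _) (f := addRightEmbedding 1),
        ← Finset.card_insert_of_notMem (a := 0) (s := Finset.map _ _) (by simp)]
      refine Finset.card_le_card fun e he => ?_
      rw [Finset.mem_filter, Finset.mem_range] at he
      rcases e with _ | e
      · exact Finset.mem_insert_self _ _
      · refine Finset.mem_insert_of_mem (Finset.mem_map.2 ⟨e, ?_, rfl⟩)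
        rw [Finset.mem_filter, Finset.mem_range]
        refine ⟨by omega, ?_⟩
        simpa [treeMass] using exists_of_halfMass_ne_zero he.2
    have hcard' : (((Finset.range (D + 1)).filter fun e =>
        halfMass (pairCode code) (treeMass code z τ E) e (false, i)
          (!pairCode code (false, i) e) ≠ 0).card : ℝ) ≤ ((Finset.range D).filter fun e =>
        ∃ j ∈ cell code e i, j ≠ i ∧ z (false, j) ≠ 0).card + 1 := by exact_mod_cast hcard
    nlinarith
  all_goals
    intro q hq hne
    rw [cell_eq_singleton hinj, Finset.mem_singleton] at hq
    exact absurd hq hne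

/-- The clock of the light node above `i` that rings first changes. -/
def WinnerLost (code : ι → ℕ → Bool) (y y' : ι → ℝ) (τ : ℝ) (i : ι) (E : ι → ℝ) : Prop :=
  ∃ j, IsWinner (cellRates code y (lightDepth code y τ i) i) E j ∧
    ¬ IsWinner (cellRates code y' (lightDepth code y τ i) i) E j

open Classical in
/-- The effect of changing a light coordinate, for fixed thresholds and clocks. -/
lemma discrepancy_light_le (hD : ∀ q p, (∀ e < D, code q e = code p e) → q = p) (hδ : 0 < δ)
    (hz : ∀ q, 0 ≤ z q)
    (h : ∀ q, q ≠ (true, i) → z' q = z q) (hi : z' (true, i) = z (true, i) + δ)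
    (hτ : 1 / 2 ≤ τ) (hτ1 : τ ≤ 1) (hz' : ∀ j, z' (true, j) ≤ τ) {y y' : ι → ℝ}
    (hy : y = fun j => z (true, j)) (hy' : y' = fun j => z' (true, j)) :
    discrepancy code (D + 1) (treeMass code z τ E) (treeMass code z' τ E) ≤
      δ * (2 * ((Finset.range D).filter fun e => 1 / 2 < cellMass code y' e i).card + 3) +
      ((if lightDepth code y τ i ≠ lightDepth code y' τ i then 3 else 0) +
        if WinnerLost code y y' τ i E then
          2 * cellMass code y (lightDepth code y τ i) i + δ else 0) := by
  have hinj := pairCode_injective hD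
  have hyi : ∀ j, j ≠ i → y' j = y j := fun j hj => by
    rw [hy, hy']
    exact h _ (by simpa using hj)
  have hii : y' i = y i + δ := by rw [hy, hy']; exact hi
  have hy0 : ∀ j, 0 ≤ y j := fun j => hy ▸ hz _
  have hyτ' : ∀ j, y' j ≤ τ := fun j => hy' ▸ hz' j
  have hyτ : ∀ j, y j ≤ τ := fun j => by
    rcases eq_or_ne j i with rfl | hj
    · linarith [hyτ' j]
    · exact hyi j hj ▸ hyτ' j
  have hy0' : ∀ j, 0 ≤ y' j := fun j => by
    rcases eq_or_ne j i with rfl | hj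
    · linarith [hy0 j]
    · exact hyi j hj ▸ hy0 j
  have hz0' : ∀ q, 0 ≤ z' q := fun q => by
    rcases eq_or_ne q (true, i) with rfl | hq
    · have := hy0' i
      rwa [hy'] at this
    · exact h q hq ▸ hz q
  set d := lightDepth code y τ i with hd
  have hmono : d ≤ lightDepth code y' τ i := lightDepth_mono hD hyi hδ.le hii hyτ'
  have hdD : d ≤ D := lightDepth_le hD hyτ
  have htrue : ∀ j, treeMass code z τ E (true, j) = concentrate code y τ E j := fun j => by
    rw [hy]; rfl
  have htrue' : ∀ j, treeMass code z' τ E (true, j) = concentrate code y' τ E j := fun j => by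
    rw [hy']; rfl
  have hout : ∀ q, q ∉ cell (pairCode code) (d + 1) (true, i) →
      treeMass code z τ E q = treeMass code z' τ E q := by
    rintro ⟨_ | _, j⟩ hq
    · exact (h _ (by simp)).symm
    · rw [htrue, htrue']
      exact concentrate_eq_of_notMem hD hyi hδ.le hii hyτ fun hj => hq (mem_cell_pairCode.2 ⟨rfl, hj⟩)
  have hmass : cellMass (pairCode code) (treeMass code z τ E) (d + 1) (true, i) =
      cellMass code y d i := by
    rw [cellMass, sum_cell_pairCode, Finset.sum_congr rfl fun j _ => htrue j,
      sum_concentrate hD hy0 hyτ le_rfl]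
  -- For `y'` the cut may be deeper than `d`, but concentration still preserves the mass of every
  -- node at or above its own cut.
  have hmass' : cellMass (pairCode code) (treeMass code z' τ E) (d + 1) (true, i) =
      cellMass code y d i + δ := by
    rw [cellMass, sum_cell_pairCode, Finset.sum_congr rfl fun j _ => htrue' j,
      sum_concentrate hD hy0' hyτ' hmono, cellMass_add_of_mem hyi hii self_mem_cell]
  have hm : cellMass (pairCode code) (treeMass code z' τ E) (d + 1) (true, i) =
      cellMass (pairCode code) (treeMass code z τ E) (d + 1) (true, i) + δ := by
    rw [hmass, hmass']
  have h1 := integral_sum_abs_count_sub_le hinj (Nat.succ_le_succ hdD) hout hδ.le hm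
  -- All `d` nodes above the cut weigh more than `τ ≥ 1/2`; the additional 1 is the root of the pair
  -- tree.
  have hcard : (((Finset.range (d + 1)).filter fun e =>
      halfMass (pairCode code) (treeMass code z τ E) e (true, i)
        (!pairCode code (true, i) e) ≠ 0).card : ℝ) ≤
      ((Finset.range D).filter fun e => 1 / 2 < cellMass code y' e i).card + 1 := by
    have h2 : d ≤ ((Finset.range D).filter fun e => 1 / 2 < cellMass code y' e i).card := by
      conv_lhs => rw [← Finset.card_range d]
      refine Finset.card_le_card fun e he => ?_
      rw [Finset.mem_range] at he
      rw [Finset.mem_filter, Finset.mem_range]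
      refine ⟨by omega, ?_⟩
      have h3 := lt_cellMass (lt_of_lt_of_le he hd.le)
      have h4 := cellMass_add_of_mem hyi hii (self_mem_cell (code := code) (d := e))
      linarith
    have h3 := (Finset.card_filter_le (Finset.range (d + 1)) fun e =>
      halfMass (pairCode code) (treeMass code z τ E) e (true, i)
        (!pairCode code (true, i) e) ≠ 0)
    rw [Finset.card_range] at h3
    exact_mod_cast h3.trans (Nat.succ_le_succ h2)
  have hs0 : 0 ≤ cellMass code y d i := cellMass_nonneg hy0
  have hs1 : cellMass code y d i ≤ τ := cellMass_lightDepth_le hD hyτ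
  -- If neither the cut nor the winner changes, both masses sit on the same leaf and the cost is
  -- `δ`. Otherwise all counts in the cell are paid for, `2 * s + δ` in mean with `s` the old mass
  -- of the cell; when the cut moves, 3 is used as a bound for `2 * s`, as `s ≤ τ ≤ 1`.
  have hcell : ∫ t, ∑ q ∈ cell (pairCode code) (d + 1) (true, i),
      |(nodeCount (pairCode code) (treeMass code z τ E) t (D + 1) q : ℝ) -
        nodeCount (pairCode code) (treeMass code z' τ E) t (D + 1) q| ∂seeds ≤
      δ + ((if d ≠ lightDepth code y' τ i then 3 else 0) +
        if WinnerLost code y y' τ i E then 2 * cellMass code y d i + δ else 0) := by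
    have hadd := integral_cell_le_add (d := d + 1) (p := (true, i)) hinj (Nat.succ_le_succ hdD)
      (treeMass_nonneg (code := code) (τ := τ) (E := E) hz)
      (treeMass_nonneg (code := code) (τ := τ) (E := E) hz0')
    rw [hmass, hmass'] at hadd
    by_cases c1 : d ≠ lightDepth code y' τ i
    · rw [if_pos c1]
      split_ifs <;> linarith
    · by_cases c2 : WinnerLost code y y' τ i E
      · rw [if_neg c1, if_pos c2]
        linarith
      · rw [if_neg c1, if_neg c2]
        rw [not_not] at c1
        simp only [WinnerLost, not_exists, not_and, not_not, ← hd] at c2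
        obtain ⟨r, hr⟩ := exists_isWinner (W := cellRates code y' d i) (E := E)
          ⟨i, by rw [cellRates_self]; linarith [hy0 i]⟩
        rw [integral_cell_of_single (r := (true, r)) hinj (Nat.succ_le_succ hdD) hout hδ.le hm
          (mem_cell_pairCode.2 ⟨rfl, hr.mem_cell⟩)]
        · linarith
        · rintro ⟨b, j⟩ hq hne
          obtain ⟨rfl, hj⟩ := mem_cell_pairCode.1 hq
          rw [htrue]
          by_contra h0
          have hw := isWinner_of_concentrate_ne_zero h0
          rw [lightDepth_congr hD hyτ (by rwa [← hd]), ← hd, cellRates_congr hj] at hw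
          exact hne (by rw [(c2 j hw).unique hr])
        · rintro ⟨b, j⟩ hq hne
          obtain ⟨rfl, hj⟩ := mem_cell_pairCode.1 hq
          rw [htrue']
          by_contra h0
          have hw := isWinner_of_concentrate_ne_zero h0
          rw [lightDepth_congr hD hyτ' (by rwa [← c1]), ← c1, cellRates_congr hj] at hw
          exact hne (by rw [hw.unique hr])
  refine h1.trans ?_
  nlinarith

/-- The threshold for the mass of light nodes, uniform in `[1/2, 1)`. -/
noncomputable def nodeThreshold (u : ℝ) : ℝ := (1 + Int.fract u) / 2

lemma half_le_nodeThreshold (u : ℝ) : 1 / 2 ≤ nodeThreshold u := by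
  unfold nodeThreshold
  linarith [Int.fract_nonneg u]

lemma nodeThreshold_le_one (u : ℝ) : nodeThreshold u ≤ 1 := by
  unfold nodeThreshold
  linarith [Int.fract_lt_one u]

lemma unif_fract_mem_le (a b : ℝ) :
    unif {u | a ≤ Int.fract u ∧ Int.fract u < b} ≤ ENNReal.ofReal (b - a) := by
  have hm : MeasurableSet {u : ℝ | a ≤ Int.fract u ∧ Int.fract u < b} := by
    rw [Set.ofPred_and]
    exact (measurableSet_le measurable_const measurable_fract).inter
      (measurableSet_lt measurable_fract measurable_const)
  rw [unif, Measure.restrict_apply hm, ← Real.volume_Ico]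
  refine measure_mono fun u hu => ?_
  obtain ⟨⟨h1, h2⟩, h3⟩ := hu
  rw [Int.fract_eq_self.2 ⟨h3.1, h3.2⟩] at h1 h2
  exact ⟨h1, h2⟩

-- The cut moves only if `τ` separates the old mass `m` of an ancestor from `m + δ`. As `τ` is
-- uniform on an interval of length `1/2`, this has probability at most `2 * δ`, and only ancestors
-- of new mass above `1/2` can be responsible.
open Classical in
lemma unif_lightDepth_ne_le (hD : ∀ q p, (∀ e < D, code q e = code p e) → q = p) (hδ : 0 ≤ δ)
    {y y' : ι → ℝ} (h : ∀ j, j ≠ i → y' j = y j) (hi : y' i = y i + δ)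
    (hy' : ∀ j, y' j ≤ 1 / 2) :
    unif {u | lightDepth code y (nodeThreshold u) i ≠ lightDepth code y' (nodeThreshold u) i} ≤
      ENNReal.ofReal
        (2 * δ * ((Finset.range D).filter fun e => 1 / 2 < cellMass code y' e i).card) := by
  set F := (Finset.range D).filter fun e => 1 / 2 < cellMass code y' e i with hF
  have hsub : {u | lightDepth code y (nodeThreshold u) i ≠ lightDepth code y' (nodeThreshold u) i} ⊆
      ⋃ e ∈ F, {u | 2 * cellMass code y e i - 1 ≤ Int.fract u ∧
        Int.fract u < 2 * cellMass code y e i - 1 + 2 * δ} := by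
    intro u hu
    have hyτ' : ∀ j, y' j ≤ nodeThreshold u := fun j => (hy' j).trans (half_le_nodeThreshold u)
    have hyτ : ∀ j, y j ≤ nodeThreshold u := fun j => by
      rcases eq_or_ne j i with rfl | hj
      · linarith [hyτ' j]
      · exact h j hj ▸ hyτ' j
    have hlt := lt_of_le_of_ne (lightDepth_mono hD h hδ hi hyτ') hu
    have h1 := cellMass_lightDepth_le hD hyτ (i := i)
    have h2 := lt_cellMass hlt
    have h3 := half_le_nodeThreshold u
    rw [Set.mem_iUnion₂]
    refine ⟨lightDepth code y (nodeThreshold u) i, ?_, ?_⟩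
    · rw [hF, Finset.mem_filter, Finset.mem_range]
      exact ⟨hlt.trans_le (lightDepth_le hD hyτ'), by linarith⟩
    · rw [cellMass_add_of_mem h hi self_mem_cell] at h2
      have h4 : nodeThreshold u = (1 + Int.fract u) / 2 := rfl
      refine ⟨?_, ?_⟩
      · linarith
      · linarith
  refine (measure_mono hsub).trans ((measure_biUnion_finset_le _ _).trans ?_)
  refine (Finset.sum_le_sum fun e _ => unif_fract_mem_le _ _).trans ?_
  rw [← ENNReal.ofReal_sum_of_nonneg fun e _ => by linarith]
  refine ENNReal.ofReal_le_ofReal ?_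
  simp only [add_sub_cancel_left, Finset.sum_const, nsmul_eq_mul]
  exact (mul_comm _ _).le

open Classical in
/-- The expected effect of changing a light coordinate. -/
lemma lintegral_discrepancy_light_le (hD : ∀ q p, (∀ e < D, code q e = code p e) → q = p)
    (hδ : 0 < δ) (hz : ∀ q, 0 ≤ z q)
    (h : ∀ q, q ≠ (true, i) → z' q = z q) (hi : z' (true, i) = z (true, i) + δ)
    (hz' : ∀ j, z' (true, j) ≤ 1 / 2) :
    ∫⁻ u, ∫⁻ E, ENNReal.ofReal (discrepancy code (D + 1) (treeMass code z (nodeThreshold u) E)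
      (treeMass code z' (nodeThreshold u) E)) ∂(clocks ι) ∂unif ≤
      ENNReal.ofReal (δ * (8 * ((Finset.range D).filter fun e =>
        1 / 2 < cellMass code (fun j => z' (true, j)) e i).card + 5)) := by
  set y : ι → ℝ := fun j => z (true, j) with hy
  set y' : ι → ℝ := fun j => z' (true, j) with hy'
  set c := ((Finset.range D).filter fun e => 1 / 2 < cellMass code y' e i).card with hc
  have hyi : ∀ j, j ≠ i → y' j = y j := fun j hj => h _ (by simpa using hj)
  have hy0 : ∀ j, 0 ≤ y j := fun j => hz _
  have hinner : ∀ u, ∫⁻ E, ENNReal.ofReal (discrepancy code (D + 1)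
      (treeMass code z (nodeThreshold u) E) (treeMass code z' (nodeThreshold u) E)) ∂(clocks ι) ≤
      ENNReal.ofReal (δ * (2 * c + 5)) + {u | lightDepth code y (nodeThreshold u) i ≠
        lightDepth code y' (nodeThreshold u) i}.indicator (fun _ => 3) u := by
    intro u
    set τ := nodeThreshold u
    set d := lightDepth code y τ i with hd
    set s := cellMass code y d i with hs
    have hs0 : 0 ≤ s := cellMass_nonneg hy0
    set I := {u | lightDepth code y (nodeThreshold u) i ≠
        lightDepth code y' (nodeThreshold u) i}.indicator (fun _ => (3 : ENNReal)) u with hI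
    have hpt : ∀ E, ENNReal.ofReal (discrepancy code (D + 1) (treeMass code z τ E)
        (treeMass code z' τ E)) ≤ (ENNReal.ofReal (δ * (2 * c + 3)) + I) +
          {E | WinnerLost code y y' τ i E}.indicator (fun _ => ENNReal.ofReal (2 * s + δ)) E := by
      intro E
      refine (ENNReal.ofReal_le_ofReal (discrepancy_light_le hD hδ hz h hi
        (half_le_nodeThreshold u) (nodeThreshold_le_one u)
        (fun j => (hz' j).trans (half_le_nodeThreshold u)) hy hy')).trans ?_
      rw [ENNReal.ofReal_add (by positivity) (by split_ifs <;> linarith),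
        ENNReal.ofReal_add (by split_ifs <;> norm_num) (by split_ifs <;> linarith), ← add_assoc]
      refine add_le_add (add_le_add le_rfl ?_) ?_
      · simp only [hI, Set.indicator, Set.mem_ofPred_eq]
        split_ifs <;> simp
      · simp only [Set.indicator, Set.mem_ofPred_eq]
        split_ifs
        · exact le_rfl
        · simp
    refine (lintegral_mono hpt).trans ?_
    rw [lintegral_add_left measurable_const, lintegral_const, measure_univ, mul_one]
    -- The cost `2 * s + δ` of a new winner is offset by its probability, at most `δ / (s + δ)`.
    have hlost : ∫⁻ E, {E | WinnerLost code y y' τ i E}.indicator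
        (fun _ => ENNReal.ofReal (2 * s + δ)) E ∂(clocks ι) ≤ ENNReal.ofReal (2 * δ) := by
      refine (lintegral_indicator_const_le _ _).trans ?_
      rcases hs0.eq_or_lt with h0 | h0
      · have : {E | WinnerLost code y y' τ i E} = ∅ := by
          refine Set.eq_empty_of_forall_notMem ?_
          rintro E ⟨j, hj, -⟩
          have h1 := (Finset.sum_eq_zero_iff_of_nonneg fun j _ => hy0 j).1 h0.symm j hj.mem_cell
          have h2 := hj.1
          rw [cellRates, if_pos hj.mem_cell, h1] at h2
          exact h2.false
        rw [this, measure_empty, mul_zero]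
        exact bot_le
      · have hrates : ∀ j, j ≠ i → cellRates code y' d i j = cellRates code y d i j := by
          intro j hj
          unfold cellRates
          rw [hyi j hj]
        have h1 := clocks_isWinner_ne_le (fun j => cellRates_nonneg (code := code) (d := d) (i := i)
          (j := j) hy0) (by rw [sum_cellRates]; exact h0) hrates hδ.le
          (by rw [cellRates_self, cellRates_self]; exact hi)
        rw [sum_cellRates, cellMass_add_of_mem hyi hi self_mem_cell] at h1
        rw [← ofReal_measureReal, ← ENNReal.ofReal_mul (by linarith)]
        refine ENNReal.ofReal_le_ofReal ?_
        have h2 : (clocks ι).real {E | WinnerLost code y y' τ i E} ≤ δ / (s + δ) := h1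
        have h3 : (2 * s + δ) * (δ / (s + δ)) ≤ 2 * δ := by
          rw [mul_div_assoc', div_le_iff₀ (by linarith)]
          nlinarith
        exact (mul_le_mul_of_nonneg_left h2 (by linarith)).trans h3
    refine (add_le_add le_rfl hlost).trans ?_
    rw [add_right_comm, ← ENNReal.ofReal_add (by positivity) (by positivity)]
    refine add_le_add (ENNReal.ofReal_le_ofReal ?_) le_rfl
    linarith
  refine (lintegral_mono hinner).trans ?_
  rw [lintegral_add_left measurable_const, lintegral_const, measure_univ, mul_one]
  -- A moving cut adds `3 * (2 * δ * c)` to `δ * (2 * c + 5)`, whence the coefficient 8.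
  refine (add_le_add le_rfl ((lintegral_indicator_const_le _ _).trans
    (mul_le_mul_right (unif_lightDepth_ne_le hD hδ.le hyi hi hz') _))).trans ?_
  rw [show (3 : ENNReal) = ENNReal.ofReal 3 by simp, ← ENNReal.ofReal_mul (by norm_num),
    ← ENNReal.ofReal_add (by positivity) (by positivity)]
  refine ENNReal.ofReal_le_ofReal (le_of_eq ?_)
  rw [← hc]
  ring

end OneCoordinate

/-! ### Random leaf positions -/

section RandomPositions

variable {n : ℕ}

/-- The bits of the leaf to which the permutation `σ` sends `v`. -/
def permCode (σ : Equiv.Perm (Fin n → Bool)) (v : Fin n → Bool) (d : ℕ) : Bool :=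
  if h : d < n then σ v ⟨d, h⟩ else false

lemma permCode_injective (σ : Equiv.Perm (Fin n → Bool)) (q p : Fin n → Bool)
    (h : ∀ e < n, permCode σ q e = permCode σ p e) : q = p := by
  refine σ.injective (funext fun e => ?_)
  have := h e e.2
  simpa [permCode] using this

variable {i j j' : Fin n → Bool} {d : ℕ}

lemma card_prefix_eq (v : Fin n → Bool) (hd : d ≤ n) :
    (Finset.univ.filter fun u : Fin n → Bool => ∀ e : Fin n, (e : ℕ) < d → u e = v e).card * 2 ^ d =
      2 ^ n := by
  have h1 : (Finset.univ.filter fun u : Fin n → Bool => ∀ e : Fin n, (e : ℕ) < d → u e = v e) =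
      Fintype.piFinset fun e : Fin n => if (e : ℕ) < d then {v e} else Finset.univ := by
    ext u
    simp only [Finset.mem_filter, Finset.mem_univ, true_and, Fintype.mem_piFinset]
    refine forall_congr' fun e => ?_
    split_ifs with h <;> simp [h]
  have h2 : (2 : ℕ) ^ d = ∏ e : Fin n, if (e : ℕ) < d then 2 else 1 := by
    rw [Finset.prod_ite, Finset.prod_const_one, mul_one, Finset.prod_const, Fin.card_filter_val_lt,
      min_eq_right hd]
  have h3 : (2 : ℕ) ^ n = ∏ _e : Fin n, 2 := by simp
  rw [h1, Fintype.card_piFinset, h2, h3, ← Finset.prod_mul_distrib]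
  refine Finset.prod_congr rfl fun e _ => ?_
  split_ifs <;> simp

lemma card_cell_permCode (σ : Equiv.Perm (Fin n → Bool)) (hd : d ≤ n) :
    (cell (permCode σ) d i).card * 2 ^ d = 2 ^ n := by
  rw [← card_prefix_eq (σ i) hd, ← Finset.card_map (f := σ.toEmbedding)]
  congr 2
  ext u
  simp only [Finset.mem_map_equiv, mem_cell, Finset.mem_filter, Finset.mem_univ, true_and, permCode,
    Equiv.apply_symm_apply]
  constructor
  · intro h e he
    simpa using h e he
  · intro h e he
    have := h ⟨e, by omega⟩ he
    simpa [show e < n by omega] using this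

/-- The permutations that send `i` and `j` below the same node at depth `d`. -/
def collisions (d : ℕ) (i j : Fin n → Bool) : Finset (Equiv.Perm (Fin n → Bool)) :=
  Finset.univ.filter fun σ => j ∈ cell (permCode σ) d i

/-- Composing with the transposition of `j` and `j'` is a bijection that leaves the position of `i`
unchanged. -/
lemma card_collisions_congr (hj : j ≠ i) (hj' : j' ≠ i) :
    (collisions d i j).card = (collisions d i j').card := by
  refine Finset.card_bij' (fun σ _ => σ * Equiv.swap j j') (fun σ _ => σ * Equiv.swap j j')
    ?_ ?_ ?_ ?_
  · intro σ hσ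
    simp only [collisions, Finset.mem_filter, Finset.mem_univ, true_and, mem_cell, permCode] at hσ ⊢
    simpa [Equiv.swap_apply_of_ne_of_ne hj.symm hj'.symm] using hσ
  · intro σ hσ
    simp only [collisions, Finset.mem_filter, Finset.mem_univ, true_and, mem_cell, permCode] at hσ ⊢
    simpa [Equiv.swap_apply_of_ne_of_ne hj.symm hj'.symm] using hσ
  · intro σ _
    simp [mul_assoc]
  · intro σ _
    simp [mul_assoc]

lemma sum_card_collisions (hd : d ≤ n) :
    (∑ j, (collisions d i j).card) * 2 ^ d =
      Fintype.card (Equiv.Perm (Fin n → Bool)) * 2 ^ n := by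
  have h1 : ∑ j, (collisions d i j).card =
      ∑ σ : Equiv.Perm (Fin n → Bool), (cell (permCode σ) d i).card := by
    simp only [collisions, Finset.card_filter]
    rw [Finset.sum_comm]
    refine Finset.sum_congr rfl fun σ _ => ?_
    rw [← Finset.card_filter]
    congr 1
    ext j
    simp
  rw [h1, Finset.sum_mul, Finset.sum_congr rfl fun σ _ => card_cell_permCode σ hd,
    Finset.sum_const, Finset.card_univ, smul_eq_mul]

/-- By symmetry each `j ≠ i` collides with `i` with probability `(2 ^ (n - d) - 1) / (2 ^ n - 1) ≤ 2
^ (-d)`, from the exact size of a cell. -/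
lemma card_collisions_le (hj : j ≠ i) (hd : d ≤ n) :
    (collisions d i j).card * 2 ^ d ≤ Fintype.card (Equiv.Perm (Fin n → Bool)) := by
  set P := Fintype.card (Equiv.Perm (Fin n → Bool)) with hP
  have h1 := sum_card_collisions (i := i) hd
  have hself : (collisions d i i).card = P := by
    rw [hP, ← Finset.card_univ, collisions, Finset.filter_true_of_mem fun σ _ => self_mem_cell]
  have h2 : ∑ j', (collisions d i j').card = P + (2 ^ n - 1) * (collisions d i j).card := by
    rw [← Finset.add_sum_erase _ _ (Finset.mem_univ i), hself,
      Finset.sum_congr rfl fun j' hj' => card_collisions_congr (Finset.ne_of_mem_erase hj') hj,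
      Finset.sum_const, Finset.card_erase_of_mem (Finset.mem_univ i), Finset.card_univ,
      smul_eq_mul]
    simp
  rw [h2] at h1
  obtain ⟨m, hm⟩ : ∃ m, 2 ^ n = m + 2 := by
    have hn : n ≠ 0 := by
      rintro rfl
      exact hj (Subsingleton.elim _ _)
    have : 2 ^ 1 ≤ 2 ^ n := Nat.pow_le_pow_right (by norm_num) (by omega)
    exact ⟨2 ^ n - 2, by omega⟩
  have hd1 : 1 ≤ 2 ^ d := Nat.one_le_two_pow
  rw [← hP, hm, show m + 2 - 1 = m + 1 by omega] at h1
  have h3 : (m + 1) * ((collisions d i j).card * 2 ^ d) ≤ (m + 1) * P := by nlinarith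
  exact Nat.le_of_mul_le_mul_left h3 (by omega)

/-- The first `L` terms are at most 1 each, and the rest is dominated by a geometric series of sum
2. -/
lemma sum_min_geometric_le (L n : ℕ) :
    ∑ d ∈ Finset.range n, min 1 ((2 : ℝ) ^ L / 2 ^ d) ≤ L + 2 := by
  have hpos : ∀ d, (0 : ℝ) ≤ min 1 ((2 : ℝ) ^ L / 2 ^ d) := fun d => by positivity
  have h1 : ∑ d ∈ Finset.range n, min 1 ((2 : ℝ) ^ L / 2 ^ d) ≤
      ∑ d ∈ Finset.range (L + n), min 1 ((2 : ℝ) ^ L / 2 ^ d) :=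
    Finset.sum_le_sum_of_subset_of_nonneg (Finset.range_mono (by omega)) fun d _ _ => hpos d
  refine h1.trans ?_
  rw [Finset.sum_range_add]
  have h2 : ∑ d ∈ Finset.range L, min 1 ((2 : ℝ) ^ L / 2 ^ d) ≤ ∑ d ∈ Finset.range L, 1 :=
    Finset.sum_le_sum fun d _ => min_le_left _ _
  have h3 : ∑ d ∈ Finset.range n, min 1 ((2 : ℝ) ^ L / 2 ^ (L + d)) ≤
      ∑ d ∈ Finset.range n, (1 / (2 : ℝ)) ^ d := by
    refine Finset.sum_le_sum fun d _ => (min_le_right _ _).trans (le_of_eq ?_)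
    rw [pow_add, one_div, inv_pow]
    field_simp
  have h4 := sum_geometric_two_le n
  simp only [Finset.sum_const, Finset.card_range, nsmul_eq_mul, mul_one] at h2
  linarith

open Classical in
/-- The depths at which the node above `i` holds much mass besides that of `i`. -/
noncomputable def crowdedDepths (x : (Fin n → Bool) → ℝ) (σ : Equiv.Perm (Fin n → Bool))
    (i : Fin n → Bool) : Finset ℕ :=
  (Finset.range n).filter fun d => 1 ≤ ∑ j ∈ (cell (permCode σ) d i).erase i, 8 * x j

/-- On average over the leaf positions, only logarithmically many ancestors are crowded. -/
lemma sum_card_crowdedDepths_le {x : (Fin n → Bool) → ℝ} (hx : ∀ i, 0 ≤ x i) {k : ℕ}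
    (hxk : ∑ i, x i ≤ k) (i : Fin n → Bool) :
    ∑ σ, ((crowdedDepths x σ i).card : ℝ) ≤
      Fintype.card (Equiv.Perm (Fin n → Bool)) * (Nat.log 2 k + 6 : ℕ) := by
  classical
  set P := Fintype.card (Equiv.Perm (Fin n → Bool)) with hP
  -- Markov's inequality: the mean of eight times the mass beside `i` is at most `8 * k / 2 ^ d`,
  -- and `8 * k ≤ 2 ^ (Nat.log 2 k + 4)` because the logarithm is rounded down.
  have hone : ∀ d ∈ Finset.range n, ((Finset.univ.filter fun σ : Equiv.Perm (Fin n → Bool) =>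
      1 ≤ ∑ j ∈ (cell (permCode σ) d i).erase i, 8 * x j).card : ℝ) ≤
      P * min 1 ((2 : ℝ) ^ (Nat.log 2 k + 4) / 2 ^ d) := by
    intro d hd
    have hd' : d ≤ n := (Finset.mem_range.1 hd).le
    rw [mul_min_of_nonneg _ _ (Nat.cast_nonneg _), mul_one]
    refine le_min ?_ ?_
    · rw [hP, ← Finset.card_univ]
      exact_mod_cast Finset.card_filter_le _ _
    · have h1 : ((Finset.univ.filter fun σ : Equiv.Perm (Fin n → Bool) =>
          1 ≤ ∑ j ∈ (cell (permCode σ) d i).erase i, 8 * x j).card : ℝ) ≤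
          ∑ σ : Equiv.Perm (Fin n → Bool), ∑ j ∈ (cell (permCode σ) d i).erase i, 8 * x j := by
        rw [Finset.card_filter, Nat.cast_sum]
        refine Finset.sum_le_sum fun σ _ => ?_
        split_ifs with h
        · simpa using h
        · simpa using Finset.sum_nonneg fun j _ => mul_nonneg (by norm_num) (hx j)
      have h2 : ∑ σ : Equiv.Perm (Fin n → Bool), ∑ j ∈ (cell (permCode σ) d i).erase i, 8 * x j =
          ∑ j ∈ Finset.univ.erase i, ((collisions d i j).card : ℝ) * (8 * x j) := by
        have : ∀ σ : Equiv.Perm (Fin n → Bool), ∑ j ∈ (cell (permCode σ) d i).erase i, 8 * x j =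
            ∑ j ∈ Finset.univ.erase i, if j ∈ cell (permCode σ) d i then 8 * x j else 0 := by
          intro σ
          rw [← Finset.sum_filter]
          congr 1
          ext j
          simp [and_comm]
        rw [Finset.sum_congr rfl fun σ _ => this σ, Finset.sum_comm]
        refine Finset.sum_congr rfl fun j _ => ?_
        rw [← Finset.sum_filter, Finset.sum_const, nsmul_eq_mul]
        rfl
      have h3 : ∑ j ∈ Finset.univ.erase i, ((collisions d i j).card : ℝ) * (8 * x j) ≤
          ∑ j ∈ Finset.univ.erase i, (P / 2 ^ d) * (8 * x j) := by
        refine Finset.sum_le_sum fun j hj => mul_le_mul_of_nonneg_right ?_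
          (mul_nonneg (by norm_num) (hx j))
        rw [le_div_iff₀ (by positivity)]
        exact_mod_cast card_collisions_le (Finset.ne_of_mem_erase hj) hd'
      have h4 : ∑ j ∈ Finset.univ.erase i, x j ≤ k :=
        (Finset.sum_le_sum_of_subset_of_nonneg (Finset.erase_subset _ _)
          fun j _ _ => hx j).trans hxk
      have h5 : (8 * k : ℝ) ≤ 2 ^ (Nat.log 2 k + 4) := by
        have := (Nat.lt_pow_succ_log_self (by norm_num : 1 < 2) k).le
        have h : 8 * k ≤ 2 ^ (Nat.log 2 k + 4) := by
          rw [pow_succ] at this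
          rw [pow_add]
          omega
        exact_mod_cast h
      rw [← Finset.mul_sum, ← Finset.mul_sum] at h3
      refine (h1.trans (h2.le.trans h3)).trans ?_
      rw [mul_div_assoc', div_mul_eq_mul_div]
      gcongr
      linarith
  have hswap : ∑ σ, ((crowdedDepths x σ i).card : ℝ) = ∑ d ∈ Finset.range n,
      ((Finset.univ.filter fun σ : Equiv.Perm (Fin n → Bool) =>
        1 ≤ ∑ j ∈ (cell (permCode σ) d i).erase i, 8 * x j).card : ℝ) := by
    simp only [crowdedDepths, Finset.card_filter, Nat.cast_sum]
    rw [Finset.sum_comm]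
  rw [hswap]
  refine (Finset.sum_le_sum hone).trans ?_
  rw [← Finset.mul_sum]
  refine mul_le_mul_of_nonneg_left ((sum_min_geometric_le _ _).trans (le_of_eq ?_))
    (Nat.cast_nonneg _)
  push_cast
  ring

end RandomPositions

/-! ### Rounding a split mass vector -/

section Measurability

variable {ι α : Type*} [Fintype ι] [MeasurableSpace α] {code : ι → ℕ → Bool} {f : α → ℝ}
  {g : α → ι → ℝ}

lemma Measurable.nodeCount {h : α → ℕ → ℝ} (hg : Measurable g) (hh : Measurable h) {d : ℕ} {p : ι} :
    Measurable fun a => nodeCount code (g a) (h a) d p := by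
  have h1 : Measurable fun a => (g a, h a) := hg.prodMk hh
  have h2 := (measurable_count (code := code) (d := d) (p := p)).comp h1
  simpa only [Function.comp_def] using h2

lemma Measurable.concentrate {y : ι → ℝ} {i : ι} (hf : Measurable f) (hg : Measurable g) :
    Measurable fun a => concentrate code y (f a) (g a) i := by
  have h1 : Measurable fun a => (f a, g a) := hf.prodMk hg
  have h2 := (measurable_concentrate (code := code) (y := y) (i := i)).comp h1
  simpa only [Function.comp_def] using h2

lemma Measurable.treeMass {z : Bool × ι → ℝ} (hf : Measurable f) (hg : Measurable g) :
    Measurable fun a => treeMass code z (f a) (g a) := by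
  refine measurable_pi_lambda _ fun q => ?_
  obtain ⟨b, i⟩ := q
  cases b
  · simp only [_root_.treeMass, Bool.false_eq_true, if_false]
    exact measurable_const
  · simp only [_root_.treeMass, if_true]
    exact hf.concentrate hg

lemma measurable_nodeThreshold : Measurable nodeThreshold := by
  unfold nodeThreshold
  exact (measurable_const.add measurable_fract).div_const _

end Measurability

section Rounding

variable {n : ℕ}

instance permMeasurableSpace : MeasurableSpace (Equiv.Perm (Fin n → Bool)) := ⊤

instance : DiscreteMeasurableSpace (Equiv.Perm (Fin n → Bool)) := ⟨fun _ => trivial⟩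

/-- The uniform distribution on the leaf positions. -/
noncomputable def unifPerm (n : ℕ) : Measure (Equiv.Perm (Fin n → Bool)) :=
  (Fintype.card (Equiv.Perm (Fin n → Bool)) : ENNReal)⁻¹ • Measure.count

instance : IsProbabilityMeasure (unifPerm n) := ⟨by
  rw [unifPerm, Measure.smul_apply, Measure.count_univ, ENat.card_eq_coe_fintype_card, smul_eq_mul]
  exact ENNReal.inv_mul_cancel (by simp [Fintype.card_ne_zero]) (by simp)⟩

/-- The random choices of the rounding procedure: leaf positions, node threshold, clocks, and
seeds of the levels. -/
abbrev Choices (n : ℕ) : Type :=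
  Equiv.Perm (Fin n → Bool) × ℝ × ((Fin n → Bool) → ℝ) × (ℕ → ℝ)

/-- The distribution of the random choices of the rounding procedure. -/
noncomputable def choices (n : ℕ) : Measure (Choices n) :=
  (unifPerm n).prod (unif.prod ((clocks (Fin n → Bool)).prod seeds))

instance : IsProbabilityMeasure (choices n) := by unfold choices; infer_instance

/-- The count of a leaf in the rounding procedure. -/
noncomputable def leafCount (z : Bool × (Fin n → Bool) → ℝ) (ω : Choices n)
    (q : Bool × (Fin n → Bool)) : ℤ :=
  nodeCount (pairCode (permCode ω.1)) (treeMass (permCode ω.1) z (nodeThreshold ω.2.1) ω.2.2.1)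
    ω.2.2.2 (n + 1) q

variable {z z' z'' : Bool × (Fin n → Bool) → ℝ} {q : Bool × (Fin n → Bool)}

lemma measurable_leafCount : Measurable fun ω : Choices n => leafCount z ω q := by
  refine measurable_from_prod_countable_right fun σ => ?_
  have h : Measurable fun a : ℝ × ((Fin n → Bool) → ℝ) × (ℕ → ℝ) =>
      treeMass (permCode σ) z (nodeThreshold a.1) a.2.1 :=
    Measurable.treeMass (measurable_nodeThreshold.comp measurable_fst)
      (measurable_fst.comp measurable_snd)
  exact h.nodeCount (code := pairCode (permCode σ)) (d := n + 1) (p := q)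
    (measurable_snd.comp measurable_snd)

lemma measurable_leafCount_real : Measurable fun ω : Choices n => (leafCount z ω q : ℝ) :=
  (measurable_of_countable (fun N : ℤ => (N : ℝ))).comp measurable_leafCount

lemma measurable_sum_abs_leafCount : Measurable fun ω : Choices n =>
    ENNReal.ofReal (∑ q, |(leafCount z ω q : ℝ) - leafCount z' ω q|) :=
  (Finset.measurable_fun_sum _ fun _ _ =>
    (measurable_leafCount_real.sub measurable_leafCount_real).abs).ennreal_ofReal

/-- The expected `ℓ₁`-distance between the roundings of two mass vectors. -/
noncomputable def roundingDist (z z' : Bool × (Fin n → Bool) → ℝ) : ENNReal :=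
  ∫⁻ ω, ENNReal.ofReal (∑ q, |(leafCount z ω q : ℝ) - leafCount z' ω q|) ∂(choices n)

lemma roundingDist_self : roundingDist z z = 0 := by simp [roundingDist]

lemma roundingDist_comm : roundingDist z z' = roundingDist z' z := by
  simp only [roundingDist, abs_sub_comm]

lemma roundingDist_triangle : roundingDist z z'' ≤ roundingDist z z' + roundingDist z' z'' := by
  unfold roundingDist
  rw [← lintegral_add_left measurable_sum_abs_leafCount]
  refine lintegral_mono fun ω => ?_
  rw [← ENNReal.ofReal_add (Finset.sum_nonneg fun _ _ => abs_nonneg _)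
    (Finset.sum_nonneg fun _ _ => abs_nonneg _), ← Finset.sum_add_distrib]
  exact ENNReal.ofReal_le_ofReal (Finset.sum_le_sum fun q _ => abs_sub_le _ _ _)

lemma lintegral_choices {f : Choices n → ENNReal} (hf : Measurable f) :
    ∫⁻ ω, f ω ∂(choices n) = ∫⁻ σ, ∫⁻ u, ∫⁻ E, ∫⁻ t, f (σ, u, E, t) ∂seeds
      ∂(clocks (Fin n → Bool)) ∂unif ∂(unifPerm n) := by
  rw [choices, lintegral_prod _ hf.aemeasurable]
  refine lintegral_congr fun σ => ?_
  have h1 : Measurable fun a => f (σ, a) := hf.comp measurable_prodMk_left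
  rw [lintegral_prod _ h1.aemeasurable]
  refine lintegral_congr fun u => ?_
  have h2 : Measurable fun a => f (σ, u, a) := h1.comp measurable_prodMk_left
  rw [lintegral_prod _ h2.aemeasurable]

lemma lintegral_unifPerm (f : Equiv.Perm (Fin n → Bool) → ENNReal) :
    ∫⁻ σ, f σ ∂(unifPerm n) =
      (Fintype.card (Equiv.Perm (Fin n → Bool)) : ENNReal)⁻¹ * ∑ σ, f σ := by
  rw [unifPerm, lintegral_smul_measure, lintegral_count, tsum_fintype, smul_eq_mul]

lemma roundingDist_eq : roundingDist z z' = ∫⁻ σ, ∫⁻ u, ∫⁻ E, ENNReal.ofReal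
    (discrepancy (permCode σ) (n + 1) (treeMass (permCode σ) z (nodeThreshold u) E)
      (treeMass (permCode σ) z' (nodeThreshold u) E)) ∂(clocks (Fin n → Bool)) ∂unif
      ∂(unifPerm n) := by
  rw [roundingDist, lintegral_choices measurable_sum_abs_leafCount]
  refine lintegral_congr fun σ => lintegral_congr fun u => lintegral_congr fun E => ?_
  rw [discrepancy, ofReal_integral_eq_lintegral_ofReal]
  · rfl
  · exact integrable_finsetSum _ fun q _ => (integrable_count.sub integrable_count).abs
  · exact Filter.Eventually.of_forall fun t => Finset.sum_nonneg fun _ _ => abs_nonneg _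

/-- A mass vector whose heavy and light parts are compatible with the weights `x`. -/
def IsSplit (x : (Fin n → Bool) → ℝ) (z : Bool × (Fin n → Bool) → ℝ) : Prop :=
  (∀ q, 0 ≤ z q) ∧ (∀ i, z (false, i) ≠ 0 → 1 ≤ 8 * x i) ∧
    ∀ i, z (true, i) ≤ 1 / 4 ∧ z (true, i) ≤ x i

lemma IsSplit.of_le {x : (Fin n → Bool) → ℝ} (h : IsSplit x z') (hz : ∀ q, 0 ≤ z q)
    (hle : ∀ q, z q ≤ z' q) : IsSplit x z := by
  refine ⟨hz, fun i hi => h.2.1 i fun h0 => hi ?_, fun i => ⟨(hle _).trans (h.2.2 i).1,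
    (hle _).trans (h.2.2 i).2⟩⟩
  exact le_antisymm (h0 ▸ hle _) (hz _)

/-- Both kinds of entries are charged to crowded depths. One heavy entry beside `i` already gives `8
* x j ≥ 1`; a light cell heavier than `1/2` holds more than `1/4` besides the at most `1/4` of `i`.
-/
lemma lintegral_discrepancy_le (σ : Equiv.Perm (Fin n → Bool)) {x : (Fin n → Bool) → ℝ}
    (hx : ∀ i, 0 ≤ x i) (h' : IsSplit x z') (hz : ∀ q, 0 ≤ z q) {δ : ℝ} (hδ : 0 < δ)
    (h : ∀ r, r ≠ q → z' r = z r) (hq : z' q = z q + δ) :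
    ∫⁻ u, ∫⁻ E, ENNReal.ofReal (discrepancy (permCode σ) (n + 1)
      (treeMass (permCode σ) z (nodeThreshold u) E)
      (treeMass (permCode σ) z' (nodeThreshold u) E)) ∂(clocks (Fin n → Bool)) ∂unif ≤
      ENNReal.ofReal (δ * (8 * (crowdedDepths x σ q.2).card + 5)) := by
  classical
  obtain ⟨b, i⟩ := q
  have hle : ∀ q, z q ≤ z' q := fun r => by
    rcases eq_or_ne r (b, i) with rfl | hr
    · linarith
    · exact (h r hr).ge
  have hs := h'.of_le hz hle
  cases b
  · have hsub (_ : DecidablePred fun e => ∃ j ∈ cell (permCode σ) e i, j ≠ i ∧ z (false, j) ≠ 0) :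
        ((Finset.range n).filter fun e =>
        ∃ j ∈ cell (permCode σ) e i, j ≠ i ∧ z (false, j) ≠ 0).card ≤
        (crowdedDepths x σ i).card := by
      refine Finset.card_le_card fun e he => ?_
      rw [Finset.mem_filter] at he
      obtain ⟨he, j, hj, hji, hjz⟩ := he
      refine Finset.mem_filter.2 ⟨he, (hs.2.1 j hjz).trans ?_⟩
      exact Finset.single_le_sum (f := fun j => 8 * x j)
        (fun j _ => mul_nonneg (by norm_num) (hx j)) (Finset.mem_erase.2 ⟨hji, hj⟩)
    have hpt : ∀ u E, ENNReal.ofReal (discrepancy (permCode σ) (n + 1)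
      (treeMass (permCode σ) z (nodeThreshold u) E)
      (treeMass (permCode σ) z' (nodeThreshold u) E)) ≤
        ENNReal.ofReal (δ * (8 * (crowdedDepths x σ i).card + 5)) := by
      intro u E
      refine ENNReal.ofReal_le_ofReal
        ((discrepancy_heavy_le (permCode_injective σ) hδ.le h hq).trans ?_)
      refine (mul_le_mul_of_nonneg_left (add_le_add (mul_le_mul_of_nonneg_left
        (Nat.cast_le.2 (hsub _)) zero_le_two) le_rfl) hδ.le).trans ?_
      refine mul_le_mul_of_nonneg_left ?_ hδ.le
      have : (0 : ℝ) ≤ (crowdedDepths x σ i).card := Nat.cast_nonneg _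
      linarith
    refine (lintegral_mono fun u => lintegral_mono fun E => hpt u E).trans ?_
    simp
  · refine (lintegral_discrepancy_light_le (permCode_injective σ) hδ hz h hq
      fun j => (h'.2.2 j).1.trans (by norm_num)).trans (ENNReal.ofReal_le_ofReal ?_)
    refine mul_le_mul_of_nonneg_left ?_ hδ.le
    have hsub : ((Finset.range n).filter fun e =>
        1 / 2 < cellMass (permCode σ) (fun j => z' (true, j)) e i).card ≤
        (crowdedDepths x σ i).card := by
      refine Finset.card_le_card fun e he => ?_
      rw [Finset.mem_filter] at he
      refine Finset.mem_filter.2 ⟨he.1, ?_⟩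
      have h1 := he.2
      rw [cellMass, ← Finset.add_sum_erase _ _ self_mem_cell] at h1
      have h2 := (h'.2.2 i).1
      have h3 : ∑ j ∈ (cell (permCode σ) e i).erase i, z' (true, j) ≤
          ∑ j ∈ (cell (permCode σ) e i).erase i, x j :=
        Finset.sum_le_sum fun j _ => (h'.2.2 j).2
      rw [← Finset.mul_sum]
      linarith
    have : (((Finset.range n).filter fun e =>
        1 / 2 < cellMass (permCode σ) (fun j => z' (true, j)) e i).card : ℝ) ≤
        (crowdedDepths x σ i).card := by exact_mod_cast hsub
    linarith

lemma roundingDist_le_of_coordinate {x : (Fin n → Bool) → ℝ} (hx : ∀ i, 0 ≤ x i) {k : ℕ}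
    (hxk : ∑ i, x i ≤ k) (h' : IsSplit x z') (hz : ∀ q, 0 ≤ z q) {δ : ℝ} (hδ : 0 < δ)
    (h : ∀ r, r ≠ q → z' r = z r) (hq : z' q = z q + δ) :
    roundingDist z z' ≤ ENNReal.ofReal ((8 * (Nat.log 2 k + 6 : ℕ) + 5) * δ) := by
  rw [roundingDist_eq]
  refine (lintegral_mono fun σ => lintegral_discrepancy_le σ hx h' hz hδ h hq).trans ?_
  rw [lintegral_unifPerm, ← ENNReal.ofReal_sum_of_nonneg fun σ _ => by positivity]
  set P := Fintype.card (Equiv.Perm (Fin n → Bool)) with hP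
  have hP0 : (0 : ℝ) < P := by
    rw [hP]
    exact_mod_cast Fintype.card_pos
  have h1 := sum_card_crowdedDepths_le hx hxk q.2
  have h2 : ∑ σ, δ * (8 * ((crowdedDepths x σ q.2).card : ℝ) + 5) ≤
      P * ((8 * (Nat.log 2 k + 6 : ℕ) + 5) * δ) := by
    rw [← Finset.mul_sum, Finset.sum_add_distrib, ← Finset.mul_sum, Finset.sum_const,
      Finset.card_univ, nsmul_eq_mul, ← hP]
    nlinarith
  rw [ENNReal.inv_mul_le_iff (by exact_mod_cast hP0.ne') (by simp)]
  refine (ENNReal.ofReal_le_ofReal h2).trans ?_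
  rw [ENNReal.ofReal_mul hP0.le, ENNReal.ofReal_natCast]

/-- The coordinates are raised one at a time. Every intermediate vector is below `z'`, hence still
compatible with the same weights `x`. -/
lemma roundingDist_le_of_le {x : (Fin n → Bool) → ℝ} (hx : ∀ i, 0 ≤ x i) {k : ℕ}
    (hxk : ∑ i, x i ≤ k) (h' : IsSplit x z') (hz : ∀ q, 0 ≤ z q) (hle : ∀ q, z q ≤ z' q) :
    roundingDist z z' ≤ ENNReal.ofReal ((8 * (Nat.log 2 k + 6 : ℕ) + 5) * ∑ q, (z' q - z q)) := by
  classical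
  have key : ∀ S : Finset (Bool × (Fin n → Bool)), roundingDist z (fun q => if q ∈ S then z' q
      else z q) ≤ ENNReal.ofReal ((8 * (Nat.log 2 k + 6 : ℕ) + 5) * ∑ q ∈ S, (z' q - z q)) := by
    intro S
    induction S using Finset.induction_on with
    | empty => simp [roundingDist_self]
    | insert q S hqS ih =>
      rw [Finset.sum_insert hqS, mul_add, add_comm, ENNReal.ofReal_add
        (mul_nonneg (by positivity) (Finset.sum_nonneg fun q _ => sub_nonneg.2 (hle q)))
        (mul_nonneg (by positivity) (sub_nonneg.2 (hle q)))]
      refine roundingDist_triangle.trans (add_le_add ih ?_)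
      have hw : ∀ r, r ≠ q → (if r ∈ insert q S then z' r else z r) =
          if r ∈ S then z' r else z r := fun r hr => by
        simp [Finset.mem_insert, hr]
      rcases (hle q).eq_or_lt with heq | hlt
      · have : (fun r => if r ∈ insert q S then z' r else z r) =
            fun r => if r ∈ S then z' r else z r := by
          funext r
          rcases eq_or_ne r q with rfl | hr
          · simp [heq]
          · exact hw r hr
        rw [this, roundingDist_self]
        exact bot_le
      · refine roundingDist_le_of_coordinate hx hxk (q := q) (h'.of_le ?_ ?_) ?_
          (sub_pos.2 hlt) hw ?_
        · intro r
          split_ifs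
          exacts [h'.1 r, hz r]
        · intro r
          split_ifs
          exacts [le_rfl, hle r]
        · intro r
          split_ifs
          exacts [h'.1 r, hz r]
        · simp [hqS]
  simpa using key Finset.univ

/-- The rounding procedure is Lipschitz on split mass vectors. -/
lemma roundingDist_le {x y : (Fin n → Bool) → ℝ} (hx : ∀ i, 0 ≤ x i) (hy : ∀ i, 0 ≤ y i) {k : ℕ}
    (hxk : ∑ i, x i ≤ k) (hyk : ∑ i, y i ≤ k) (h : IsSplit x z) (h' : IsSplit y z') :
    roundingDist z z' ≤
      ENNReal.ofReal ((8 * (Nat.log 2 k + 6 : ℕ) + 5) * ∑ q, |z q - z' q|) := by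
  -- The detour through the minimum makes both legs monotone, each with its own weights, and their
  -- lengths add up to the `ℓ₁`-distance.
  have h0 : ∀ q, 0 ≤ min (z q) (z' q) := fun q => le_min (h.1 q) (h'.1 q)
  have h1 := roundingDist_le_of_le hx hxk h h0 fun q => min_le_left _ _
  have h2 := roundingDist_le_of_le hy hyk h' h0 fun q => min_le_right _ _
  rw [roundingDist_comm] at h1
  refine (roundingDist_triangle.trans (add_le_add h1 h2)).trans ?_
  rw [← ENNReal.ofReal_add (mul_nonneg (by positivity)
    (Finset.sum_nonneg fun q _ => sub_nonneg.2 (min_le_left _ _))) (mul_nonneg (by positivity)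
    (Finset.sum_nonneg fun q _ => sub_nonneg.2 (min_le_right _ _))), ← mul_add,
    ← Finset.sum_add_distrib]
  refine ENNReal.ofReal_le_ofReal (mul_le_mul_of_nonneg_left (Finset.sum_le_sum fun q _ => ?_)
    (by positivity))
  rcases le_total (z q) (z' q) with hq | hq
  · rw [min_eq_left hq, abs_of_nonpos (by linarith)]
    linarith
  · rw [min_eq_right hq, abs_of_nonneg (by linarith)]
    linarith

/-- The rounding procedure preserves masses in expectation. -/
lemma lintegral_leafCount (hz : ∀ q, 0 ≤ z q) :
    ∫⁻ ω, ENNReal.ofReal (leafCount z ω q) ∂(choices n) = ENNReal.ofReal (z q) := by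
  rw [lintegral_choices measurable_leafCount_real.ennreal_ofReal]
  have h1 : ∀ σ u E, ∫⁻ t, ENNReal.ofReal (leafCount z (σ, u, E, t) q) ∂seeds =
      ENNReal.ofReal (treeMass (permCode σ) z (nodeThreshold u) E q) := by
    intro σ u E
    rw [← ofReal_integral_eq_lintegral_ofReal]
    · change ENNReal.ofReal (∫ t, (nodeCount (pairCode (permCode σ)) (treeMass (permCode σ) z
        (nodeThreshold u) E) t (n + 1) q : ℝ) ∂seeds) = _
      rw [integral_nodeCount, cellMass,
        cell_eq_singleton (pairCode_injective (permCode_injective σ)), Finset.sum_singleton]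
    · exact integrable_count (code := pairCode (permCode σ)) (z := treeMass (permCode σ) z
        (nodeThreshold u) E) (d := n + 1) (p := q)
    · exact Filter.Eventually.of_forall fun t => Int.cast_nonneg
        (nodeCount_nonneg (code := pairCode (permCode σ)) (z := treeMass (permCode σ) z
          (nodeThreshold u) E) (treeMass_nonneg hz))
  have h2 : ∀ σ u, ∫⁻ E, ENNReal.ofReal (treeMass (permCode σ) z (nodeThreshold u) E q)
      ∂(clocks (Fin n → Bool)) = ENNReal.ofReal (z q) := by
    intro σ u
    obtain ⟨b, i⟩ := q
    cases b
    · simp [treeMass]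
    · have hm : Measurable fun E => concentrate (permCode σ) (fun j => z (true, j))
          (nodeThreshold u) E i := measurable_const.concentrate measurable_id
      simp only [treeMass, if_true]
      rw [← ofReal_integral_eq_lintegral_ofReal, integral_concentrate fun j => hz _]
      · refine Integrable.of_bound hm.aestronglyMeasurable (∑ j, z (true, j))
          (Filter.Eventually.of_forall fun E => ?_)
        rw [Real.norm_eq_abs, abs_of_nonneg (concentrate_nonneg fun j => hz _)]
        unfold concentrate
        split_ifs
        · exact Finset.sum_le_sum_of_subset_of_nonneg (Finset.subset_univ _) fun j _ _ => hz _
        · exact Finset.sum_nonneg fun j _ => hz _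
      · exact Filter.Eventually.of_forall fun E => concentrate_nonneg fun j => hz _
  simp only [h1, h2, lintegral_const, measure_univ, mul_one]

end Rounding

/-! ### Properties of the leaf counts -/

section LeafCount

variable {n : ℕ} {z : Bool × (Fin n → Bool) → ℝ} {ω : Choices n} {q : Bool × (Fin n → Bool)}
  {v : Fin n → Bool}

lemma isRounding_leafCount : IsRounding
    (treeMass (permCode ω.1) z (nodeThreshold ω.2.1) ω.2.2.1 q) (leafCount z ω q) :=
  isRounding_count_leaf (pairCode_injective (permCode_injective ω.1))

lemma leafCount_nonneg (hz : ∀ q, 0 ≤ z q) : 0 ≤ leafCount z ω q :=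
  isRounding_leafCount.nonneg (treeMass_nonneg hz q)

lemma leafCount_le_one (hz : ∀ q, 0 ≤ z q) (hz1 : ∀ q, z q ≤ 1)
    (hlight : ∀ v, z (true, v) ≤ 1 / 2) : leafCount z ω q ≤ 1 := by
  refine isRounding_leafCount.le_one ?_
  unfold treeMass
  split_ifs
  · exact (concentrate_le (permCode_injective ω.1) (fun j => hz _)
      fun j => (hlight j).trans (half_le_nodeThreshold _)).trans (nodeThreshold_le_one _)
  · exact hz1 q

lemma leafCount_eq_zero (h : z q = 0) : leafCount z ω q = 0 := by
  have h1 : treeMass (permCode ω.1) z (nodeThreshold ω.2.1) ω.2.2.1 q = 0 := by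
    obtain ⟨b, v⟩ := q
    cases b
    · simpa [treeMass] using h
    · simpa [treeMass] using concentrate_eq_zero (y := fun j => z (true, j)) h
  exact (h1 ▸ isRounding_leafCount (z := z) (ω := ω) (q := q)).eq_zero

/-- Concentration preserves the total mass, and the leaf counts sum to the root count. -/
lemma isRounding_sum_leafCount (hz : ∀ q, 0 ≤ z q) (hlight : ∀ v, z (true, v) ≤ 1 / 2) :
    IsRounding (∑ q, z q) (∑ q, leafCount z ω q) := by
  set m := treeMass (permCode ω.1) z (nodeThreshold ω.2.1) ω.2.2.1 with hm
  have h1 : ∑ q, m q = ∑ q, z q := by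
    rw [Fintype.sum_prod_type, Fintype.sum_prod_type, Fintype.sum_bool, Fintype.sum_bool]
    simp only [hm, treeMass, if_true, Bool.false_eq_true, if_false]
    rw [sum_univ_concentrate (permCode_injective ω.1) (fun j => hz _)
      fun j => (hlight j).trans (half_le_nodeThreshold _)]
  have p : Bool × (Fin n → Bool) := (true, fun _ => true)
  have h2 := isRounding_count (code := pairCode (permCode ω.1)) (z := m) (t := ω.2.2.2) (d := 0)
    (p := p)
  have h3 := sum_count (z := m) (t := ω.2.2.2) (p := p)
    (pairCode_injective (permCode_injective ω.1)) (Nat.zero_le (n + 1))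
  rw [cell_zero] at h3
  rw [cellMass_zero, h1] at h2
  have h4 : ∑ q, leafCount z ω q = nodeCount (pairCode (permCode ω.1)) m ω.2.2.2 0 p := by
    exact_mod_cast h3
  rwa [h4]

end LeafCount

/-! ### Random splitting into heavy and light entries -/

section Split

variable {ι : Type*} {x y : ι → ℝ} {s : ι → Bool} {v : ι}

/-- The mass vector in which the entries selected by `s` are light and the others are heavy. -/
def splitMass (x : ι → ℝ) (s : ι → Bool) (q : Bool × ι) : ℝ := if q.1 = s q.2 then x q.2 else 0

/-- The threshold that separates the heavy entries from the light entries. -/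
noncomputable def weightThreshold (u : ℝ) : ℝ := (1 + Int.fract u) / 8

open Classical in
/-- The light entries. -/
noncomputable def lightEntries (x : ι → ℝ) (u : ℝ) (v : ι) : Bool := decide (x v ≤ weightThreshold u)

lemma splitMass_nonneg (hx : ∀ v, 0 ≤ x v) (q : Bool × ι) : 0 ≤ splitMass x s q := by
  unfold splitMass
  split_ifs
  exacts [hx _, le_rfl]

lemma splitMass_le (hx : ∀ v, 0 ≤ x v) (q : Bool × ι) : splitMass x s q ≤ x q.2 := by
  unfold splitMass
  split_ifs
  exacts [le_rfl, hx _]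

lemma splitMass_add : splitMass x s (true, v) + splitMass x s (false, v) = x v := by
  unfold splitMass
  cases s v <;> simp

lemma splitMass_eq_zero (h : x v = 0) (b : Bool) : splitMass x s (b, v) = 0 := by
  simp [splitMass, h]

lemma splitMass_eq_zero_or : splitMass x s (true, v) = 0 ∨ splitMass x s (false, v) = 0 := by
  unfold splitMass
  cases s v <;> simp

lemma sum_splitMass [Fintype ι] : ∑ q, splitMass x s q = ∑ v, x v := by
  rw [Fintype.sum_prod_type, Fintype.sum_bool, ← Finset.sum_add_distrib]
  simp only [splitMass_add]

lemma splitMass_light_le (u : ℝ) :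
    splitMass x (lightEntries x u) (true, v) ≤ 1 / 4 := by
  unfold splitMass
  split_ifs with h
  · have h1 : x v ≤ weightThreshold u := by simpa [lightEntries] using h.symm
    refine h1.trans ?_
    unfold weightThreshold
    linarith [Int.fract_lt_one u]
  · norm_num

lemma isSplit_splitMass {n : ℕ} {x : (Fin n → Bool) → ℝ} (hx : ∀ v, 0 ≤ x v) (u : ℝ) :
    IsSplit x (splitMass x (lightEntries x u)) := by
  refine ⟨splitMass_nonneg hx, fun v hv => ?_, fun v => ⟨splitMass_light_le u, splitMass_le hx _⟩⟩
  have h1 : ¬ x v ≤ weightThreshold u := fun h => hv (by simp [splitMass, lightEntries, h])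
  unfold weightThreshold at h1
  linarith [Int.fract_nonneg u]

lemma measurable_lightEntries : Measurable fun u => lightEntries x u := by
  refine measurable_pi_lambda _ fun v => measurable_to_bool ?_
  have : (fun u => lightEntries x u v) ⁻¹' {true} = {u | x v ≤ weightThreshold u} := by
    ext u
    simp [lightEntries]
  rw [this]
  unfold weightThreshold
  exact measurableSet_le measurable_const ((measurable_const.add measurable_fract).div_const _)

/-- The expected distance of the random splits. -/
lemma lintegral_splitMass_sub_le [Fintype ι] (hx : ∀ v, 0 ≤ x v) (hx1 : ∀ v, x v ≤ 1)
    (hy : ∀ v, 0 ≤ y v) (hy1 : ∀ v, y v ≤ 1) :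
    ∫⁻ u, ENNReal.ofReal
      (∑ q, |splitMass x (lightEntries x u) q - splitMass y (lightEntries y u) q|) ∂unif ≤
      ENNReal.ofReal (17 * ∑ v, |x v - y v|) := by
  -- `I v` holds the seeds whose threshold, uniform in `[1/8, 1/4)`, separates `x v` from `y v`; its
  -- probability is at most `8 * |x v - y v|`. On it the cost is at most `x v + y v ≤ 2`, off it `|x
  -- v - y v|`, and `17 = 1 + 2 * 8`.
  set I : ι → Set ℝ := fun v => {u | 8 * min (x v) (y v) - 1 ≤ Int.fract u ∧
    Int.fract u < 8 * max (x v) (y v) - 1} with hI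
  have hIm : ∀ v, MeasurableSet (I v) := fun v =>
    (measurableSet_le measurable_const measurable_fract).inter
      (measurableSet_lt measurable_fract measurable_const)
  have hpt : ∀ u, ENNReal.ofReal
      (∑ q, |splitMass x (lightEntries x u) q - splitMass y (lightEntries y u) q|) ≤
      ∑ v, (ENNReal.ofReal |x v - y v| + (I v).indicator (fun _ => 2) u) := by
    intro u
    rw [Fintype.sum_prod_type, Fintype.sum_bool, ← Finset.sum_add_distrib,
      ENNReal.ofReal_sum_of_nonneg fun v _ => by positivity]
    refine Finset.sum_le_sum fun v _ => ?_
    by_cases hu : u ∈ I v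
    · rw [Set.indicator_of_mem hu, show (2 : ENNReal) = ENNReal.ofReal 2 by simp,
        ← ENNReal.ofReal_add (abs_nonneg _) (by norm_num)]
      refine ENNReal.ofReal_le_ofReal ?_
      have h1 : ∀ b, |splitMass x (lightEntries x u) (b, v) - splitMass y (lightEntries y u) (b, v)|
          ≤ splitMass x (lightEntries x u) (b, v) + splitMass y (lightEntries y u) (b, v) := by
        intro b
        have h2 := splitMass_nonneg (s := lightEntries x u) hx (b, v)
        have h3 := splitMass_nonneg (s := lightEntries y u) hy (b, v)
        rw [abs_le]
        constructor <;> linarith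
      have h4 := splitMass_add (x := x) (s := lightEntries x u) (v := v)
      have h5 := splitMass_add (x := y) (s := lightEntries y u) (v := v)
      linarith [h1 true, h1 false, hx1 v, hy1 v, abs_nonneg (x v - y v)]
    · rw [Set.indicator_of_notMem hu, add_zero]
      refine ENNReal.ofReal_le_ofReal ?_
      have hs : lightEntries x u v = lightEntries y u v := by
        have h1 : ¬ (min (x v) (y v) ≤ weightThreshold u ∧ weightThreshold u < max (x v) (y v)) := by
          rintro ⟨h2, h3⟩
          unfold weightThreshold at h2 h3
          exact hu ⟨by linarith, by linarith⟩
        unfold lightEntries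
        rw [decide_eq_decide]
        rw [not_and_or, not_le, not_lt, lt_min_iff, max_le_iff] at h1
        rcases h1 with h1 | h1
        · exact iff_of_false h1.1.not_ge h1.2.not_ge
        · exact iff_of_true h1.1 h1.2
      unfold splitMass
      cases h : lightEntries y u v <;> simp [hs, h]
  refine (lintegral_mono hpt).trans ?_
  have hmeas : ∀ v, Measurable fun u => ENNReal.ofReal |x v - y v| +
      (I v).indicator (fun _ => (2 : ENNReal)) u := fun v =>
    (measurable_const.indicator (hIm v)).const_add _
  rw [lintegral_finsetSum _ fun v _ => hmeas v, Finset.mul_sum,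
    ENNReal.ofReal_sum_of_nonneg fun v _ => by positivity]
  refine Finset.sum_le_sum fun v _ => ?_
  rw [lintegral_add_left measurable_const, lintegral_const, measure_univ, mul_one,
    lintegral_indicator_const (hIm v)]
  have h1 : unif (I v) ≤ ENNReal.ofReal (8 * |x v - y v|) := by
    refine (unif_fract_mem_le _ _).trans (ENNReal.ofReal_le_ofReal ?_)
    rw [← max_sub_min_eq_abs]
    rw [max_comm, min_comm]
    linarith
  rw [show 17 * |x v - y v| = |x v - y v| + 2 * (8 * |x v - y v|) by ring,
    ENNReal.ofReal_add (abs_nonneg _) (by positivity), ENNReal.ofReal_mul (by norm_num),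
    ENNReal.ofReal_ofNat]
  gcongr

end Split

/-! ### The correlated sampling algorithm on the leaves -/

section Sampling

variable {n : ℕ} {x y : (Fin n → Bool) → ℝ} {v : Fin n → Bool} {a : ℝ × Choices n}

/-- The leaf counts for a random split of `x`. -/
noncomputable def splitLeafCount (x : (Fin n → Bool) → ℝ) (a : ℝ × Choices n)
    (q : Bool × (Fin n → Bool)) : ℤ :=
  leafCount (splitMass x (lightEntries x a.1)) a.2 q

/-- The number of times that `v` is selected. -/
noncomputable def selected (x : (Fin n → Bool) → ℝ) (a : ℝ × Choices n) (v : Fin n → Bool) : ℤ :=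
  splitLeafCount x a (true, v) + splitLeafCount x a (false, v)

lemma measurable_splitLeafCount {q : Bool × (Fin n → Bool)} :
    Measurable fun a : ℝ × Choices n => splitLeafCount x a q := by
  have h : Measurable fun b : ((Fin n → Bool) → Bool) × Choices n =>
      leafCount (splitMass x b.1) b.2 q :=
    measurable_from_prod_countable_right fun s =>
      measurable_leafCount (z := splitMass x s) (q := q)
  have h1 : Measurable fun a : ℝ × Choices n => (lightEntries x a.1, a.2) :=
    (measurable_lightEntries.comp measurable_fst).prodMk measurable_snd
  have h2 := h.comp h1
  simp only [Function.comp_def] at h2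
  simpa only [splitLeafCount] using h2

lemma measurable_splitLeafCount_real {q : Bool × (Fin n → Bool)} :
    Measurable fun a : ℝ × Choices n => (splitLeafCount x a q : ℝ) :=
  (measurable_of_countable (fun N : ℤ => (N : ℝ))).comp measurable_splitLeafCount

lemma measurable_selected : Measurable fun a : ℝ × Choices n => selected x a v :=
  measurable_splitLeafCount.add measurable_splitLeafCount

lemma selected_eq_zero (h : x v = 0) : selected x a v = 0 := by
  unfold selected splitLeafCount
  rw [leafCount_eq_zero (splitMass_eq_zero h _), leafCount_eq_zero (splitMass_eq_zero h _), add_zero]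

section

variable (hx : ∀ v, 0 ≤ x v) (hx1 : ∀ v, x v ≤ 1)
include hx

lemma splitLeafCount_nonneg (q : Bool × (Fin n → Bool)) : 0 ≤ splitLeafCount x a q :=
  leafCount_nonneg (splitMass_nonneg hx)

lemma isRounding_sum_selected : IsRounding (∑ v, x v) (∑ v, selected x a v) := by
  have h := isRounding_sum_leafCount (ω := a.2) (splitMass_nonneg (s := lightEntries x a.1) hx)
    fun v => (splitMass_light_le _).trans (by norm_num)
  rw [sum_splitMass, Fintype.sum_prod_type, Fintype.sum_bool, ← Finset.sum_add_distrib] at h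
  exact h

lemma lintegral_splitLeafCount (q : Bool × (Fin n → Bool)) :
    ∫⁻ a, ENNReal.ofReal (splitLeafCount x a q) ∂(unif.prod (choices n)) =
      ∫⁻ u, ENNReal.ofReal (splitMass x (lightEntries x u) q) ∂unif := by
  rw [lintegral_prod _ measurable_splitLeafCount_real.ennreal_ofReal.aemeasurable]
  simp only [splitLeafCount]
  exact lintegral_congr fun u => lintegral_leafCount
    (z := splitMass x (lightEntries x u)) (q := q) (splitMass_nonneg hx)

lemma lintegral_selected :
    ∫⁻ a, ENNReal.ofReal (selected x a v) ∂(unif.prod (choices n)) = ENNReal.ofReal (x v) := by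
  have hm : ∀ q, Measurable fun a : ℝ × Choices n => ENNReal.ofReal (splitLeafCount x a q) :=
    fun q => measurable_splitLeafCount_real.ennreal_ofReal
  have h : ∀ a, ENNReal.ofReal (selected x a v) = ENNReal.ofReal (splitLeafCount x a (true, v)) +
      ENNReal.ofReal (splitLeafCount x a (false, v)) := fun a => by
    rw [selected, Int.cast_add, ENNReal.ofReal_add
      (Int.cast_nonneg (splitLeafCount_nonneg hx _)) (Int.cast_nonneg (splitLeafCount_nonneg hx _))]
  have hs : Measurable fun u => ENNReal.ofReal (splitMass x (lightEntries x u) (true, v)) :=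
    ((measurable_of_countable fun s => splitMass x s (true, v)).comp
      measurable_lightEntries).ennreal_ofReal
  simp only [h]
  rw [lintegral_add_left (hm _), lintegral_splitLeafCount hx, lintegral_splitLeafCount hx,
    ← lintegral_add_left hs]
  simp only [← ENNReal.ofReal_add (splitMass_nonneg hx _) (splitMass_nonneg hx _), splitMass_add,
    lintegral_const, measure_univ, mul_one]

include hx1

/-- Only one of the two copies of `v` carries mass; the other has count 0, and no count exceeds 1.
-/
lemma selected_eq_zero_or_one : selected x a v = 0 ∨ selected x a v = 1 := by
  have h0 := splitLeafCount_nonneg (a := a) hx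
  have h1 : ∀ q, splitLeafCount x a q ≤ 1 := fun q => leafCount_le_one (splitMass_nonneg hx)
    (fun q => (splitMass_le hx q).trans (hx1 _))
    fun v => (splitMass_light_le _).trans (by norm_num)
  have h2 : splitLeafCount x a (true, v) = 0 ∨ splitLeafCount x a (false, v) = 0 :=
    splitMass_eq_zero_or.imp leafCount_eq_zero leafCount_eq_zero
  have := h0 (true, v)
  have := h0 (false, v)
  have := h1 (true, v)
  have := h1 (false, v)
  unfold selected
  omega

end

lemma lintegral_abs_selected_sub_le (hx : ∀ v, 0 ≤ x v) (hx1 : ∀ v, x v ≤ 1)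
    (hy : ∀ v, 0 ≤ y v) (hy1 : ∀ v, y v ≤ 1) {k : ℕ} (hxk : ∑ v, x v ≤ k) (hyk : ∑ v, y v ≤ k) :
    ∫⁻ a, ENNReal.ofReal (∑ v, |(selected x a v : ℝ) - selected y a v|) ∂(unif.prod (choices n)) ≤
      ENNReal.ofReal ((8 * (Nat.log 2 k + 6 : ℕ) + 5) * (17 * ∑ v, |x v - y v|)) := by
  have hm : Measurable fun a : ℝ × Choices n =>
      ENNReal.ofReal (∑ q, |(splitLeafCount x a q : ℝ) - splitLeafCount y a q|) :=
    (Finset.measurable_fun_sum _ fun q _ =>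
      (measurable_splitLeafCount_real.sub measurable_splitLeafCount_real).abs).ennreal_ofReal
  calc ∫⁻ a, ENNReal.ofReal (∑ v, |(selected x a v : ℝ) - selected y a v|) ∂(unif.prod (choices n))
      ≤ ∫⁻ a, ENNReal.ofReal (∑ q, |(splitLeafCount x a q : ℝ) - splitLeafCount y a q|)
          ∂(unif.prod (choices n)) := by
        refine lintegral_mono fun a => ENNReal.ofReal_le_ofReal ?_
        rw [Fintype.sum_prod_type, Fintype.sum_bool, ← Finset.sum_add_distrib]
        refine Finset.sum_le_sum fun v _ => ?_
        rw [selected, selected, Int.cast_add, Int.cast_add, add_sub_add_comm]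
        exact abs_add_le _ _
    _ = ∫⁻ u, roundingDist (splitMass x (lightEntries x u)) (splitMass y (lightEntries y u))
          ∂unif := lintegral_prod _ hm.aemeasurable
    _ ≤ ∫⁻ u, ENNReal.ofReal (8 * (Nat.log 2 k + 6 : ℕ) + 5) * ENNReal.ofReal
          (∑ q, |splitMass x (lightEntries x u) q - splitMass y (lightEntries y u) q|) ∂unif := by
        refine lintegral_mono fun u => ?_
        rw [← ENNReal.ofReal_mul (by positivity)]
        exact roundingDist_le hx hy hxk hyk (isSplit_splitMass hx u) (isSplit_splitMass hy u)
    _ ≤ _ := by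
        rw [lintegral_const_mul' _ _ ENNReal.ofReal_ne_top, ENNReal.ofReal_mul (by positivity)]
        gcongr
        exact lintegral_splitMass_sub_le hx hx1 hy hy1

end Sampling

/-! ### Points of the hypersimplex as mass vectors -/

section Pad

variable {n k : ℕ} {x y : Fin n → ℝ} {a : ℝ × Choices n} {i : Fin n}

/-- The leaf of the coordinate `i`. -/
def leaf (i : Fin n) : Fin n → Bool := fun j => decide (j = i)

lemma leaf_injective : Function.Injective (leaf (n := n)) := fun i j h => by
  have := congrFun h i
  simpa [leaf] using this

/-- The mass vector of a point of `ℝⁿ`. -/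
noncomputable def pad (x : Fin n → ℝ) : (Fin n → Bool) → ℝ := Function.extend leaf x 0

lemma pad_leaf (i : Fin n) : pad x (leaf i) = x i := leaf_injective.extend_apply _ _ _

lemma pad_of_notMem {v : Fin n → Bool} (hv : v ∉ Set.range (leaf (n := n))) : pad x v = 0 :=
  Function.extend_apply' _ _ _ hv

lemma pad_mem (hx : ∀ i, 0 ≤ x i ∧ x i ≤ 1) (v : Fin n → Bool) : 0 ≤ pad x v ∧ pad x v ≤ 1 := by
  by_cases hv : v ∈ Set.range (leaf (n := n))
  · obtain ⟨i, rfl⟩ := hv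
    rw [pad_leaf]
    exact hx i
  · rw [pad_of_notMem hv]
    norm_num

lemma sum_pad : ∑ v, pad x v = ∑ i, x i :=
  (Fintype.sum_of_injective leaf leaf_injective _ _ (fun _ hv => pad_of_notMem hv)
    fun i => (pad_leaf i).symm).symm

lemma sum_abs_pad_sub : ∑ v, |pad x v - pad y v| = l1Norm (x - y) :=
  (Fintype.sum_of_injective leaf leaf_injective _ _
    (fun _ hv => by rw [pad_of_notMem hv, pad_of_notMem hv, sub_zero, abs_zero])
    fun i => by rw [pad_leaf, pad_leaf, Pi.sub_apply]).symm

lemma l1Norm_eq_sum (hx : ∀ i, 0 ≤ x i) : l1Norm x = ∑ i, x i :=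
  Finset.sum_congr rfl fun i _ => abs_of_nonneg (hx i)

/-- The set selected for the point `x`. -/
noncomputable def sample (x : Fin n → ℝ) (a : ℝ × Choices n) : Finset (Fin n) :=
  Finset.univ.filter fun i => selected (pad x) a (leaf i) = 1

lemma selected_pad_eq (hx : ∀ i, 0 ≤ x i ∧ x i ≤ 1) :
    selected (pad x) a (leaf i) = if i ∈ sample x a then 1 else 0 := by
  have := selected_eq_zero_or_one (a := a) (v := leaf i) (fun v => (pad_mem hx v).1)
    fun v => (pad_mem hx v).2
  simp only [sample, Finset.mem_filter, Finset.mem_univ, true_and]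
  split_ifs with h
  · exact h
  · exact this.resolve_right h

lemma card_sample (hx : ∀ i, 0 ≤ x i ∧ x i ≤ 1) :
    (sample x a).card = ⌊l1Norm x⌋₊ ∨ (sample x a).card = ⌈l1Norm x⌉₊ := by
  have h := isRounding_sum_selected (a := a) fun v => (pad_mem hx v).1
  have h1 : ∑ v, selected (pad x) a v = (sample x a).card := by
    rw [← Fintype.sum_of_injective leaf leaf_injective _ _
      (fun _ hv => selected_eq_zero (pad_of_notMem hv)) fun i => (selected_pad_eq hx).symm]
    simp
  have h0 : 0 ≤ l1Norm x := Finset.sum_nonneg fun _ _ => abs_nonneg _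
  rw [sum_pad, ← l1Norm_eq_sum fun i => (hx i).1, h1] at h
  obtain ⟨h2, h3⟩ := h
  rw [Int.cast_natCast] at h2 h3
  rcases le_or_gt ((sample x a).card : ℝ) (l1Norm x) with h4 | h4
  · exact Or.inl ((Nat.floor_eq_iff h0).2 ⟨h4, by linarith⟩).symm
  · have h5 : (sample x a).card ≠ 0 := fun h5 => by
      rw [h5, Nat.cast_zero] at h4
      linarith
    refine Or.inr ((Nat.ceil_eq_iff h5).2 ⟨?_, h4.le⟩).symm
    rw [Nat.cast_sub (Nat.one_le_iff_ne_zero.2 h5)]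
    push_cast
    linarith

lemma card_sample_le (hx : x ∈ hypersimplex n k) : (sample x a).card ≤ k := by
  have h0 : ⌈l1Norm x⌉₊ ≤ k := Nat.ceil_le.2 hx.2
  rcases card_sample (a := a) hx.1 with h | h
  · rw [h]
    exact (Nat.floor_le_ceil _).trans h0
  · rwa [h]

lemma measurableSet_mem_sample : MeasurableSet {a | i ∈ sample x a} := by
  have : {a | i ∈ sample x a} = (fun a => selected (pad x) a (leaf i)) ⁻¹' {1} := by
    ext a
    simp [sample]
  rw [this]
  exact measurable_selected (measurableSet_singleton _)

lemma measurableSet_sample_eq (S : Finset (Fin n)) : MeasurableSet {a | sample x a = S} := by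
  have : {a | sample x a = S} = ⋂ i, {a | i ∈ sample x a ↔ i ∈ S} := by
    ext a
    simp [Finset.ext_iff]
  rw [this]
  exact MeasurableSet.iInter fun i => measurableSet_mem_sample.iff (MeasurableSet.const _)

lemma measure_mem_sample (hx : ∀ i, 0 ≤ x i ∧ x i ≤ 1) :
    (unif.prod (choices n)).real {a | i ∈ sample x a} = x i := by
  have h := lintegral_selected (v := leaf i) fun v => (pad_mem hx v).1
  have h1 : ∀ a, ENNReal.ofReal (selected (pad x) a (leaf i)) =
      {a | i ∈ sample x a}.indicator 1 a := fun a => by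
    rw [selected_pad_eq hx]
    by_cases hi : i ∈ sample x a <;> simp [hi]
  simp only [h1] at h
  rw [lintegral_indicator_one measurableSet_mem_sample, pad_leaf] at h
  rw [Measure.real, h, ENNReal.toReal_ofReal (hx i).1]

lemma integral_card_symmDiff_sample_le (hx : x ∈ hypersimplex n k) (hy : y ∈ hypersimplex n k) :
    ∫ a, ((symmDiff (sample x a) (sample y a)).card : ℝ) ∂(unif.prod (choices n)) ≤
      (8 * (Nat.log 2 k + 6 : ℕ) + 5) * (17 * l1Norm (x - y)) := by
  have hsum : ∀ {x}, x ∈ hypersimplex n k → ∑ v, pad x v ≤ k := fun {x} hx => by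
    rw [sum_pad, ← l1Norm_eq_sum fun i => (hx.1 i).1]
    exact hx.2
  have h := lintegral_abs_selected_sub_le (fun v => (pad_mem hx.1 v).1)
    (fun v => (pad_mem hx.1 v).2) (fun v => (pad_mem hy.1 v).1) (fun v => (pad_mem hy.1 v).2)
    (hsum hx) (hsum hy)
  rw [sum_abs_pad_sub] at h
  have h0 : 0 ≤ l1Norm (x - y) := Finset.sum_nonneg fun _ _ => abs_nonneg _
  have hcard : ∀ a, ∑ v, |(selected (pad x) a v : ℝ) - selected (pad y) a v| =
      (symmDiff (sample x a) (sample y a)).card := by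
    intro a
    rw [← Fintype.sum_of_injective leaf leaf_injective
      (fun i => if i ∈ symmDiff (sample x a) (sample y a) then (1 : ℝ) else 0) _ (fun v hv => by
        rw [selected_eq_zero (pad_of_notMem hv), selected_eq_zero (pad_of_notMem hv), sub_self,
          abs_zero]) fun i => ?_]
    · simp
    · rw [selected_pad_eq hx.1, selected_pad_eq hy.1]
      by_cases h1 : i ∈ sample x a <;> by_cases h2 : i ∈ sample y a <;>
        simp [h1, h2, Finset.mem_symmDiff]
  simp only [hcard] at h
  by_cases hi : Integrable (fun a => ((symmDiff (sample x a) (sample y a)).card : ℝ))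
      (unif.prod (choices n))
  · rw [← ofReal_integral_eq_lintegral_ofReal hi
      (Filter.Eventually.of_forall fun a => Nat.cast_nonneg _)] at h
    exact (ENNReal.ofReal_le_ofReal_iff (by positivity)).1 h
  -- The integral of a non-integrable function is 0 by convention, so integrability need not be
  -- proved.
  · rw [integral_undef hi]
    positivity

end Pad

/-! ### The main theorem -/

theorem theorem1 :
    ∃ C : ℝ, 0 < C ∧ ∀ n k : ℕ, 1 ≤ k →
      ∃ (Ω : Type) (_ : MeasurableSpace Ω) (μ : Measure Ω) (A : Ω → DetRounding n k),
        IsCorrelatedSampling n k (C * max 1 (Real.logb 2 (k : ℝ))) μ A := by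
  -- The stretch obtained is `17 * (8 * Nat.log 2 k + 53)`, and `8 + 53 = 61` once both summands are
  -- compared with `max 1 (Real.logb 2 k)`.
  refine ⟨17 * 61, by norm_num, fun n k hk => ⟨ℝ × Choices n, inferInstance,
    unif.prod (choices n), fun a x => ⟨sample x.1 a, card_sample_le x.2⟩, ?_⟩⟩
  refine ⟨inferInstance, fun x S => measurableSet_sample_eq S, fun a x => card_sample x.2.1,
    fun x i => measure_mem_sample x.2.1, fun x y => ?_⟩
  refine (integral_card_symmDiff_sample_le x.2 y.2).trans ?_
  have h0 : 0 ≤ l1Norm (x.1 - y.1) := Finset.sum_nonneg fun _ _ => abs_nonneg _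
  have h1 : (Nat.log 2 k : ℝ) ≤ Real.logb 2 k := by exact_mod_cast Real.natLog_le_logb k 2
  rw [← mul_assoc]
  refine mul_le_mul_of_nonneg_right ?_ h0
  push_cast
  linarith [le_max_left 1 (Real.logb 2 (k : ℝ)), le_max_right 1 (Real.logb 2 (k : ℝ))]
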